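/- Theorem 1.18. Let $G$ be a connected real linear reductive Lie group, i.e. a connected topological group isomorphic to a closed subgroup of some $\mathrm{GL}(n,\mathbb{R})$ that is stable under transposition, and let $H$ be a closed subgroup of $G$. Suppose that $G/H$ admits compact quotients, i.e. that there is a discrete subgroup $\Gamma$ of $G$ acting properly discontinuously on $G/H$ by left translations with compact orbit space $\Gamma\backslash G/H$. Then: (1) $H$ is compactly generated, i.e. generated by a compact subset; (2) $H$ is quasi-isometrically embedded in $G$. That is, for a compact generating subset $S$ of a locally compact group $L$ with $S=S^{-1}$ and containing a neighborhood of the identity, put $|\ell|_S=\min\{n\in\mathbb{N} : \ell\in S^n\}$ (with $S^0=\{1\}$) and $d_S(\ell,\ell')=|\ell^{-1}\ell'|_S$. Then such subsets exist for $H$ and for $G$, and for every such subset $S$ of $H$ and $T$ of $G$ there are constants $C\ge 1$ and $C'\ge 0$ such that $$C^{-1}\,d_S(h,h')-C'\ \le\ d_T(h,h')\ \le\ C\,d_S(h,h')+C'\qquad\text{for all } h,h'\in H.$$ -/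

import Mathlib

open scoped Pointwise Topology

/-- A topological group is real linear reductive if it is isomorphic, as a topological group, to a
closed subgroup of some `GL(n, ℝ)` that is stable under transposition. (The Cartan involution of `G`
is then `g ↦ (gᵀ)⁻¹`.) -/
def IsRealLinearReductive (G : Type*) [Group G] [TopologicalSpace G] : Prop :=
  ∃ (n : ℕ) (ρ : G →* GL (Fin n) ℝ), Topology.IsClosedEmbedding ρ ∧
    ∀ g : G, ∃ g' : G,
      (ρ g' : Matrix (Fin n) (Fin n) ℝ) = (ρ g : Matrix (Fin n) (Fin n) ℝ).transpose

/-- The homogeneous space `G ⧸ H` admits compact quotients: some discrete subgroup `Γ` of `G`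
acts on it by left translations properly discontinuously and with compact orbit space. -/
def AdmitsCompactQuotients {G : Type*} [Group G] [TopologicalSpace G] (H : Subgroup G) : Prop :=
  ∃ Γ : Subgroup G, DiscreteTopology Γ ∧ ProperlyDiscontinuousSMul Γ (G ⧸ H) ∧
    CompactSpace (Quotient (MulAction.orbitRel Γ (G ⧸ H)))

/-- A topological group is compactly generated if some compact subset generates it. -/
def IsCompactlyGeneratedGroup (Γ : Type*) [Group Γ] [TopologicalSpace Γ] : Prop :=
  ∃ S : Set Γ, IsCompact S ∧ Subgroup.closure S = ⊤

/-- The generating sets used to define word lengths: compact, symmetric, generating, and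
containing a neighborhood of the identity. -/
structure IsCompactGeneratingSet {Γ : Type*} [Group Γ] [TopologicalSpace Γ] (S : Set Γ) :
    Prop where
  isCompact : IsCompact S
  symmetric : S⁻¹ = S
  mem_nhds_one : S ∈ 𝓝 (1 : Γ)
  generates : Subgroup.closure S = ⊤

/-- `|γ|_S`, the least `n` such that `γ` is a product of `n` elements of `S` (`S ^ 0 = {1}`). -/
noncomputable def wordLength {Γ : Type*} [Group Γ] (S : Set Γ) (γ : Γ) : ℕ :=
  sInf {n : ℕ | γ ∈ S ^ n}

/-- The left-invariant word distance `d_S(γ, γ') = |γ⁻¹ γ'|_S`. -/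
noncomputable def wordDist {Γ : Type*} [Group Γ] (S : Set Γ) (γ γ' : Γ) : ℝ :=
  (wordLength S (γ⁻¹ * γ') : ℝ)

/-- `f` is a quasi-isometric embedding from `(X, dX)` to `(Y, dY)`. -/
def IsQuasiIsometricEmbedding {X Y : Type*} (dX : X → X → ℝ) (dY : Y → Y → ℝ) (f : X → Y) : Prop :=
  ∃ C C' : ℝ, 1 ≤ C ∧ 0 ≤ C' ∧ ∀ x x' : X,
    C⁻¹ * dX x x' - C' ≤ dY (f x) (f x') ∧ dY (f x) (f x') ≤ C * dX x x' + C'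

/-- The subgroup `H` is quasi-isometrically embedded in `G`: both groups carry word distances of
compact generating sets, and for all choices of these the inclusion is a quasi-isometric
embedding. -/
def IsQuasiIsometricallyEmbedded {G : Type*} [Group G] [TopologicalSpace G] (H : Subgroup G) :
    Prop :=
  (∃ S : Set H, IsCompactGeneratingSet S) ∧ (∃ T : Set G, IsCompactGeneratingSet T) ∧
    ∀ (S : Set H) (T : Set G), IsCompactGeneratingSet S → IsCompactGeneratingSet T →
      IsQuasiIsometricEmbedding (wordDist S) (wordDist T) (fun h : H => (h : G))

/-! ### Lie algebra of a closed linear group (Cartan's closed subgroup theorem). -/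

section LieAlgebraOfClosedSubgroup

open NormedSpace Filter

variable {A : Type*} [NormedRing A] [NormedAlgebra ℝ A] [FiniteDimensional ℝ A]

/-! Measure elements of G by f = `logSize`, pulled back along the linear embedding. It is
subadditive with compact sublevel sets, so f is at most affine in the word length of G. The upper
inequality is soft: a compact generating set of H lies in a power of one of G. The content is that
each h in H is a product of O(f(h) + 1) elements of a fixed compact subset of H; this also gives
compact generation.

Cocompactness provides a compact C with G = ΓCH. The engine is `exists_descent_step`: between the
factors of any product γy one may insert some s from a fixed compact set so that f(γsy) ≤ max(R,
f(γy) − δ), with constants independent of γ and y. Apply this to γ · (ch) and write sc = γ'c'h'.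
Proper discontinuity confines h' to a compact subset of H, while γch has become (γγ')c'(h'h), whose
size is at most R or has dropped by δ. Starting from h = 1·1·h, about f(h)/δ moves reach {f ≤ R},
where proper discontinuity confines the H-factor once more (`exists_compact_mem_pow`).

Uniformity in γ uses reductivity. For x = γy let v be the gradient of f along left translations by
G, up to a factor: a symmetric element of 𝔤. Inserting exp(tw) after γ multiplies x on the left by
exp(tγwγ⁻¹), so the slope is governed by u = γ⁻¹vγ, and ‖u‖² ≥ tr(u²) = tr(v²) = ‖v‖²: conjugation
cannot shrink the gradient. Finally ‖v‖ is bounded below off a compact set by pairing v with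
log(xxᵀ), which lies in 𝔤 by `log_mem`. -/

theorem completeSpace_of_finiteDimensional_real (A : Type*) [NormedRing A] [NormedAlgebra ℝ A]
    [FiniteDimensional ℝ A] : CompleteSpace A :=
  FiniteDimensional.complete ℝ A

theorem exp_add_of_commute_real {X Y : A} (h : Commute X Y) : exp (X + Y) = exp X * exp Y := by
  let := NormedAlgebra.restrictScalars ℚ ℝ A
  have := completeSpace_of_finiteDimensional_real A
  exact exp_add_of_commute h

/-- The exponential, as a unit of the algebra. -/
noncomputable def expUnit (X : A) : Aˣ where
  val := exp X
  inv := exp (-X)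
  val_inv := by
    rw [← exp_add_of_commute_real (Commute.neg_right (Commute.refl X)), add_neg_cancel, exp_zero]
  inv_val := by
    rw [← exp_add_of_commute_real (Commute.neg_left (Commute.refl X)), neg_add_cancel, exp_zero]

@[simp] theorem val_expUnit (X : A) : (expUnit X : A) = exp X := rfl

theorem expUnit_add {X Y : A} (h : Commute X Y) : expUnit (X + Y) = expUnit X * expUnit Y :=
  Units.ext (exp_add_of_commute_real h)

@[simp] theorem expUnit_zero : expUnit (0 : A) = 1 :=
  Units.ext exp_zero

theorem expUnit_neg (X : A) : expUnit (-X) = (expUnit X)⁻¹ := by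
  apply Units.ext; rfl

theorem expUnit_nsmul (k : ℕ) (X : A) : expUnit (k • X) = expUnit X ^ k := by
  induction k with
  | zero => simp
  | succ k ih => rw [succ_nsmul, expUnit_add ((Commute.refl X).smul_left k), ih, pow_succ]

theorem expUnit_zsmul (k : ℤ) (X : A) : expUnit (k • X) = expUnit X ^ k := by
  obtain ⟨m, rfl | rfl⟩ := k.eq_nat_or_neg
  · rw [natCast_zsmul, zpow_natCast, expUnit_nsmul]
  · rw [neg_smul, natCast_zsmul, expUnit_neg, zpow_neg, zpow_natCast, expUnit_nsmul]

theorem expUnit_conj (g : Aˣ) (X : A) : expUnit (g * X * (g⁻¹ : Aˣ)) = g * expUnit X * g⁻¹ := by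
  let := NormedAlgebra.restrictScalars ℚ ℝ A
  have := completeSpace_of_finiteDimensional_real A
  exact Units.ext (exp_units_conj g X)

theorem continuous_expUnit : Continuous (expUnit : A → Aˣ) := by
  let := NormedAlgebra.restrictScalars ℚ ℝ A
  have := completeSpace_of_finiteDimensional_real A
  exact Units.isOpenEmbedding_val.isInducing.continuous_iff.2 exp_continuous

/-- The generators of the one-parameter groups contained in `G`. -/
def oneParam (G : Subgroup Aˣ) : Set (A) :=
  {X | ∀ t : ℝ, expUnit (t • X) ∈ G}

variable {G : Subgroup Aˣ}

/-- The powers exp(M k) ^ ⌊t * c k⌋ stay in G and converge to exp(t X), because the discarded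
fractional part multiplies M k, which tends to 0. -/
theorem mem_oneParam_of_tendsto (hG : IsClosed (G : Set Aˣ))
    {M : ℕ → A} {c : ℕ → ℝ} {X : A}
    (hM : Tendsto M atTop (𝓝 0)) (hMG : ∀ k, expUnit (M k) ∈ G)
    (hX : Tendsto (fun k => c k • M k) atTop (𝓝 X)) : X ∈ oneParam G := by
  intro t
  have h1 : Tendsto (fun k => (⌊t * c k⌋ : ℤ) • M k) atTop (𝓝 (t • X)) := by
    have h2 : Tendsto (fun k => Int.fract (t * c k) • M k) atTop (𝓝 0) := by
      refine squeeze_zero_norm (a := fun k => ‖M k‖) (fun k => ?_) (by simpa using hM.norm)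
      rw [norm_smul, Real.norm_of_nonneg (Int.fract_nonneg _)]
      exact mul_le_of_le_one_left (norm_nonneg _) (Int.fract_lt_one _).le
    have h3 := (hX.const_smul t).sub h2
    rw [sub_zero] at h3
    refine h3.congr fun k => ?_
    rw [smul_smul, ← sub_smul, Int.self_sub_fract, Int.cast_smul_eq_zsmul]
  refine hG.mem_of_tendsto ((continuous_expUnit.tendsto _).comp h1) (Eventually.of_forall fun k => ?_)
  simp only [Function.comp, expUnit_zsmul]
  exact G.zpow_mem (hMG k) _

theorem exists_local_log : ∃ l : A → A,
    l 1 = 0 ∧ HasStrictFDerivAt l (ContinuousLinearMap.id ℝ (A)) 1 ∧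
      ∀ᶠ x in 𝓝 1, exp (l x) = x := by
  have := completeSpace_of_finiteDimensional_real A
  have h : HasStrictFDerivAt (exp : A → _)
      ((ContinuousLinearEquiv.refl ℝ (A) :
        A →L[ℝ] A)) 0 :=
    hasStrictFDerivAt_exp_zero
  refine ⟨h.localInverse _ _ _, ?_, ?_, ?_⟩
  · simpa using h.localInverse_apply_image
  · simpa using h.to_localInverse
  · simpa using h.eventually_right_inverse

theorem hasDerivAt_exp_smul_zero (X : A) :
    HasDerivAt (fun t : ℝ => exp (t • X)) X 0 := by
  have := completeSpace_of_finiteDimensional_real A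
  simpa using hasDerivAt_exp_smul_const X (0 : ℝ)

/-- The curve t ↦ log(exp(tX) exp(tY)) has derivative X + Y at 0; sample it at t = 1/(k+1) and
rescale by k + 1. -/
theorem oneParam_add (hG : IsClosed (G : Set Aˣ)) {X Y : A}
    (hX : X ∈ oneParam G) (hY : Y ∈ oneParam G) : X + Y ∈ oneParam G := by
  obtain ⟨l, hl1, hl, hle⟩ := exists_local_log (A := A)
  have hd : HasDerivAt (fun t : ℝ => exp (t • X) * exp (t • Y)) (X + Y) 0 := by
    simpa [Pi.mul_def] using (hasDerivAt_exp_smul_zero X).mul (hasDerivAt_exp_smul_zero Y)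
  have hdl : HasDerivAt (fun t : ℝ => l (exp (t • X) * exp (t • Y))) (X + Y) 0 := by
    have h1 : HasFDerivAt l (ContinuousLinearMap.id ℝ (A))
        ((fun t : ℝ => exp (t • X) * exp (t • Y)) 0) := by
      simpa using hl.hasFDerivAt
    simpa [Function.comp_def] using h1.comp_hasDerivAt (0 : ℝ) hd
  have hev : ∀ᶠ t : ℝ in 𝓝 0, exp (l (exp (t • X) * exp (t • Y))) = exp (t • X) * exp (t • Y) := by
    have := hd.continuousAt.tendsto
    simp only [zero_smul, exp_zero, mul_one] at this
    exact this.eventually hle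
  have hu : Tendsto (fun k : ℕ => ((k : ℝ) + 1)⁻¹) atTop (𝓝 0) := by
    simpa using tendsto_one_div_add_atTop_nhds_zero_nat (𝕜 := ℝ)
  obtain ⟨K, hK⟩ := eventually_atTop.1 (hu.eventually hev)
  have hu' := (tendsto_add_atTop_iff_nat K).2 hu
  refine mem_oneParam_of_tendsto hG
    (M := fun k => l (exp ((((k + K : ℕ) : ℝ) + 1)⁻¹ • X) * exp ((((k + K : ℕ) : ℝ) + 1)⁻¹ • Y)))
    (c := fun k => ((k + K : ℕ) : ℝ) + 1) ?_ ?_ ?_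
  · have := hdl.continuousAt.tendsto.comp hu'
    simpa [hl1, Function.comp_def] using this
  · intro k
    have : expUnit (l (exp ((((k + K : ℕ) : ℝ) + 1)⁻¹ • X) * exp ((((k + K : ℕ) : ℝ) + 1)⁻¹ • Y))) =
        expUnit ((((k + K : ℕ) : ℝ) + 1)⁻¹ • X) * expUnit ((((k + K : ℕ) : ℝ) + 1)⁻¹ • Y) :=
      Units.ext (hK (k + K) (Nat.le_add_left _ _))
    rw [this]
    exact G.mul_mem (hX _) (hY _)
  · have h2 := (hasDerivAt_iff_tendsto_slope_zero.1 hdl).comp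
      (tendsto_nhdsWithin_iff.2 ⟨hu', Eventually.of_forall fun k => by
        simp only [Set.mem_compl_iff, Set.mem_singleton_iff]; positivity⟩)
    refine h2.congr fun k => ?_
    simp [hl1]

/-- The Lie algebra of a closed subgroup of the general linear group. -/
def lieAlg (G : Subgroup Aˣ) (hG : IsClosed (G : Set Aˣ)) :
    Submodule ℝ (A) where
  carrier := oneParam G
  add_mem' := oneParam_add hG
  zero_mem' := fun t => by simp [G.one_mem]
  smul_mem' := fun c X hX t => by rw [smul_smul]; exact hX _

variable {hG : IsClosed (G : Set Aˣ)}

theorem expUnit_mem_of_mem_lieAlg {X : A} (hX : X ∈ lieAlg G hG) :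
    expUnit X ∈ G := by
  simpa using hX 1

theorem conj_mem_lieAlg {g : Aˣ} (hg : g ∈ G) {X : A}
    (hX : X ∈ lieAlg G hG) :
    (g : A) * X * ((g⁻¹ : Aˣ) : A) ∈ lieAlg G hG := by
  intro t
  rw [← smul_mul_assoc, ← mul_smul_comm, expUnit_conj]
  exact G.mul_mem (G.mul_mem hg (hX t)) (G.inv_mem hg)

/-- The bracket is the derivative at 0 of exp(tX) Y exp(-tX), a curve in a closed subspace. -/
theorem bracket_mem_lieAlg {X Y : A} (hX : X ∈ lieAlg G hG)
    (hY : Y ∈ lieAlg G hG) : X * Y - Y * X ∈ lieAlg G hG := by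
  have hd : HasDerivAt (fun t : ℝ => exp (t • X) * Y * exp (t • (-X))) (X * Y - Y * X) 0 := by
    have := ((hasDerivAt_exp_smul_zero X).mul_const Y).mul (hasDerivAt_exp_smul_zero (-X))
    simpa [sub_eq_add_neg, Pi.mul_def] using this
  have hc : IsClosed (lieAlg G hG : Set (A)) :=
    Submodule.closed_of_finiteDimensional _
  refine hc.mem_of_tendsto (hasDerivAt_iff_tendsto_slope_zero.1 hd) (Eventually.of_forall fun t => ?_)
  have h1 := conj_mem_lieAlg (hX t) hY
  rw [← expUnit_neg, ← smul_neg] at h1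
  exact (lieAlg G hG).smul_mem _ ((lieAlg G hG).sub_mem (by simpa using h1) (by simpa using hY))

/-- Near the identity, a closed subgroup is the exponential image of its Lie algebra. -/
theorem eventually_exists_lieAlg :
    ∀ᶠ g in 𝓝 (1 : Aˣ), g ∈ G → ∃ X ∈ lieAlg G hG, ∃ Y ∈ lieAlg G hG, g = expUnit X * expUnit Y := by
  have := completeSpace_of_finiteDimensional_real A
  obtain ⟨W, hW⟩ := (lieAlg G hG).exists_isCompl
  let p : A →L[ℝ] A :=
    LinearMap.toContinuousLinearMap ((lieAlg G hG).projection W hW)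
  let q : A →L[ℝ] A :=
    LinearMap.toContinuousLinearMap (W.projection (lieAlg G hG) hW.symm)
  have hp : ∀ X, p X ∈ lieAlg G hG := fun X => by
    simp [p]
  have hq : ∀ X, q X ∈ W := fun X => by
    simp [q]
  have hpq : p + q = ContinuousLinearMap.id ℝ _ := by
    ext1 X
    simp [p, q, Submodule.projection_add_projection_eq_self]
  have hexp : HasStrictFDerivAt (exp : A → _)
      (ContinuousLinearMap.id ℝ (A)) 0 := hasStrictFDerivAt_exp_zero
  have h : HasStrictFDerivAt (fun X => exp (p X) * exp (q X))
      ((ContinuousLinearEquiv.refl ℝ (A) :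
        A →L[ℝ] A)) 0 := by
    have h1 : HasStrictFDerivAt (fun X => exp (p X)) p 0 := by
      have h0 : HasStrictFDerivAt (exp : A → _)
        (ContinuousLinearMap.id ℝ (A)) (p 0) := by simpa using hexp
      exact h0.comp 0 p.hasStrictFDerivAt
    have h2 : HasStrictFDerivAt (fun X => exp (q X)) q 0 := by
      have h0 : HasStrictFDerivAt (exp : A → _)
        (ContinuousLinearMap.id ℝ (A)) (q 0) := by simpa using hexp
      exact h0.comp 0 q.hasStrictFDerivAt
    convert! h1.mul' h2 using 1
    ext1 X
    have := congrArg (fun L => L X) hpq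
    simpa [add_comm] using this.symm
  set l := h.localInverse _ _ _ with hl
  have hl1 : l 1 = 0 := by simpa using h.localInverse_apply_image
  have hlc : ContinuousAt l 1 := by
    simpa using h.to_localInverse.hasFDerivAt.continuousAt
  have hle : ∀ᶠ x in 𝓝 1, exp (p (l x)) * exp (q (l x)) = x := by
    simpa using h.eventually_right_inverse
  have hval : Tendsto (fun g : Aˣ => (g : A)) (𝓝 1) (𝓝 1) :=
    Units.continuous_val.tendsto' _ _ rfl
  -- If the W-components of elements of G tending to 1 were nonzero, they would exponentiate into G,
  -- and their normalizations would accumulate at a unit vector lying both in W and in the Lie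
  -- algebra.
  have key : ∀ᶠ g in 𝓝 (1 : Aˣ), g ∈ G → q (l g) ∈ lieAlg G hG := by
    by_contra hcon
    have : FirstCountableTopology Aˣ :=
      Units.isOpenEmbedding_val.isInducing.firstCountableTopology
    obtain ⟨g, hg1, hg⟩ := exists_seq_forall_of_frequently
      ((not_eventually.1 hcon).and_eventually (hval.eventually hle))
    simp only [Classical.not_imp] at hg
    set M : ℕ → A := fun k => q (l (g k)) with hMdef
    have hM0 : Tendsto M atTop (𝓝 0) := by
      have h3 : Tendsto (fun k => l (g k)) atTop (𝓝 0) := by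
        have := hlc.tendsto.comp (hval.comp hg1)
        rwa [hl1] at this
      simpa [Function.comp_def, hMdef] using (q.continuous.tendsto 0).comp h3
    have hMG : ∀ k, expUnit (M k) ∈ G := fun k => by
      have h4 : g k = expUnit (p (l (g k))) * expUnit (M k) := Units.ext (hg k).2.symm
      have h5 : expUnit (M k) = (expUnit (p (l (g k))))⁻¹ * g k := by rw [eq_inv_mul_iff_mul_eq, ← h4]
      rw [h5]
      exact G.mul_mem (G.inv_mem (expUnit_mem_of_mem_lieAlg (hG := hG) (hp _))) (hg k).1.1
    have hMne : ∀ k, M k ≠ 0 := fun k h0 => (hg k).1.2 (by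
      have h0' : q (l (g k)) = 0 := h0
      rw [h0']; exact (lieAlg G hG).zero_mem)
    have hsph : ∀ k, ‖M k‖⁻¹ • M k ∈ Metric.sphere (0 : A) 1 := fun k => by
      simp [norm_smul, inv_mul_cancel₀ (norm_ne_zero_iff.2 (hMne k))]
    have : ProperSpace (A) := FiniteDimensional.proper ℝ _
    obtain ⟨X, hX, φ, hφ, hlim⟩ := (isCompact_sphere _ _).tendsto_subseq hsph
    have hXG : X ∈ lieAlg G hG := mem_oneParam_of_tendsto hG
      (M := fun k => M (φ k)) (c := fun k => ‖M (φ k)‖⁻¹) (hM0.comp hφ.tendsto_atTop)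
      (fun k => hMG _) hlim
    have hXW : X ∈ W := (Submodule.closed_of_finiteDimensional W).mem_of_tendsto hlim
      (Eventually.of_forall fun k => W.smul_mem _ (hq _))
    have hX0 : X = 0 := by
      have : X ∈ lieAlg G hG ⊓ W := ⟨hXG, hXW⟩
      rwa [hW.inf_eq_bot] at this
    simp [hX0] at hX
  filter_upwards [key, hval.eventually hle] with g h1 h2 hg
  exact ⟨_, hp _, _, h1 hg, Units.ext h2.symm⟩

/-- A connected closed subgroup is generated by the exponentials of its Lie algebra. -/
theorem le_of_expUnit_mem [ConnectedSpace G] (N : Subgroup Aˣ)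
    (hN : ∀ X ∈ lieAlg G hG, expUnit X ∈ N) : G ≤ N := by
  have hopen : IsOpen (N.subgroupOf G : Set G) := by
    apply Subgroup.isOpen_of_mem_nhds (g := 1)
    have h1 : Tendsto (fun g : G => (g : Aˣ)) (𝓝 1) (𝓝 1) :=
      continuous_subtype_val.tendsto' _ _ rfl
    filter_upwards [h1.eventually (eventually_exists_lieAlg (G := G) (hG := hG))] with g hg
    obtain ⟨X, hX, Y, hY, h⟩ := hg g.2
    have : (g : Aˣ) ∈ N := h ▸ N.mul_mem (hN X hX) (hN Y hY)
    exact this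
  have huniv := IsClopen.eq_univ ⟨Subgroup.isClosed_of_isOpen _ hopen, hopen⟩ ⟨1, one_mem _⟩
  intro g hg
  have : (⟨g, hg⟩ : G) ∈ (N.subgroupOf G : Set G) := huniv ▸ Set.mem_univ _
  exact this

end LieAlgebraOfClosedSubgroup

/-! ### Reductive matrix Lie algebras and determinants of exponentials. -/

section MatrixLieAlgebra

open NormedSpace
open scoped Matrix

/-- `𝔤` is the Lie algebra of the connected group of matrices `G`, and is stable under
transposition. -/
structure IsReductiveLieAlgebra {n : ℕ} (G : Subgroup (GL (Fin n) ℝ))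
    (𝔤 : Submodule ℝ (Matrix (Fin n) (Fin n) ℝ)) : Prop where
  exp_mem : ∀ X ∈ 𝔤, ∀ g : GL (Fin n) ℝ, (g : Matrix (Fin n) (Fin n) ℝ) = exp X → g ∈ G
  conj_mem : ∀ g ∈ G, ∀ X ∈ 𝔤, (g : Matrix (Fin n) (Fin n) ℝ) * X * (g⁻¹ : GL (Fin n) ℝ) ∈ 𝔤
  bracket_mem : ∀ X ∈ 𝔤, ∀ Y ∈ 𝔤, X * Y - Y * X ∈ 𝔤
  transpose_mem : ∀ X ∈ 𝔤, Xᵀ ∈ 𝔤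
  generates : ∀ N : Subgroup (GL (Fin n) ℝ),
    (∀ X ∈ 𝔤, ∀ g : GL (Fin n) ℝ, (g : Matrix (Fin n) (Fin n) ℝ) = exp X → g ∈ N) → G ≤ N

-- This extracts what is needed of 𝔤 in norm-free terms; the Frobenius norm serves only to construct
-- it.
open scoped Matrix.Norms.Frobenius in
theorem exists_isReductiveLieAlgebra {n : ℕ} {G : Subgroup (GL (Fin n) ℝ)} [ConnectedSpace G]
    (hG : IsClosed (G : Set (GL (Fin n) ℝ)))
    (hT : ∀ g ∈ G, ∃ g' ∈ G, (g' : Matrix (Fin n) (Fin n) ℝ) = (g : Matrix (Fin n) (Fin n) ℝ)ᵀ) :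
    ∃ 𝔤, IsReductiveLieAlgebra G 𝔤 := by
  refine ⟨lieAlg (A := Matrix (Fin n) (Fin n) ℝ) G hG, ?_, ?_, ?_, ?_, ?_⟩
  · intro X hX g hg
    have : g = expUnit X := Units.ext hg
    rw [this]
    exact expUnit_mem_of_mem_lieAlg hX
  · exact fun g hg X hX => conj_mem_lieAlg hg hX
  · exact fun X hX Y hY => bracket_mem_lieAlg hX hY
  · intro X hX t
    obtain ⟨g', hg', h⟩ := hT _ (hX t)
    have : expUnit (t • Xᵀ) = g' := Units.ext <| by
      rw [h]
      exact (congrArg exp (Matrix.transpose_smul t X).symm).trans (Matrix.exp_transpose _)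
    rw [this]
    exact hg'
  · intro N hN
    exact @le_of_expUnit_mem _ _ _ _ G hG ‹_› N fun X hX => hN X hX _ rfl

theorem hasDerivAt_det_of_eq_one {n : ℕ} {A : ℝ → Matrix (Fin n) (Fin n) ℝ}
    {W : Matrix (Fin n) (Fin n) ℝ} (h0 : A 0 = 1)
    (hA : ∀ i j, HasDerivAt (fun t => A t i j) (W i j) 0) :
    HasDerivAt (fun t => (A t).det) W.trace 0 := by
  let P : (Fin n → Fin n → ℝ) → ℝ := fun M => (Matrix.of M).det
  have hP : Differentiable ℝ P := by
    simp only [P, Matrix.det_apply, Matrix.of_apply]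
    fun_prop
  have key : ∀ B : ℝ → Matrix (Fin n) (Fin n) ℝ, B 0 = 1 →
      (∀ i j, HasDerivAt (fun t => B t i j) (W i j) 0) →
      HasDerivAt (fun t => (B t).det) (fderiv ℝ P (fun i j => (1 : Matrix (Fin n) (Fin n) ℝ) i j)
        (fun i j => W i j)) 0 := by
    intro B hB0 hB
    have h1 : HasDerivAt (fun t => (fun i j => B t i j : Fin n → Fin n → ℝ)) (fun i j => W i j) 0 :=
      hasDerivAt_pi.2 fun i => hasDerivAt_pi.2 fun j => hB i j
    have h2 := (hP (fun i j => B 0 i j)).hasFDerivAt.comp_hasDerivAt 0 h1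
    rw [hB0] at h2
    exact h2
  have h3 : HasDerivAt (fun t : ℝ => (1 + t • W).det) W.trace 0 := by
    rw [funext fun t => Matrix.det_one_add_smul t W]
    set p := (1 + (Polynomial.X : Polynomial ℝ) • W.map ⇑Polynomial.C).det.divX.divX
    have h4 := ((hasDerivAt_id (0 : ℝ)).const_mul W.trace).const_add 1
    have h5 := (p.hasDerivAt 0).mul (hasDerivAt_pow 2 (0 : ℝ))
    simpa [Pi.add_def, Pi.mul_def] using h4.add h5
  have h6 := key (fun t => 1 + t • W) (by simp) fun i j => by
    simpa using ((hasDerivAt_id (0 : ℝ)).mul_const (W i j)).const_add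
      ((1 : Matrix (Fin n) (Fin n) ℝ) i j)
  rw [h3.unique h6]
  exact key A h0 hA

open scoped Matrix.Norms.Frobenius in
theorem hasDerivAt_exp_smul_apply {n : ℕ} (Z : Matrix (Fin n) (Fin n) ℝ) (i j : Fin n) :
    HasDerivAt (fun t : ℝ => exp (t • Z) i j) (Z i j) 0 := by
  have h := hasDerivAt_exp_smul_zero Z
  let e : Matrix (Fin n) (Fin n) ℝ →L[ℝ] ℝ :=
    LinearMap.toContinuousLinearMap (Matrix.entryLinearMap ℝ ℝ i j)
  exact e.hasFDerivAt.comp_hasDerivAt 0 h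

theorem mul_add_one_sub_mul {n : ℕ} {x y E : Matrix (Fin n) (Fin n) ℝ} (hE : E * E = E)
    (hy : Commute y E) :
    (x * E + (1 - E)) * (y * E + (1 - E)) = x * y * E + (1 - E) := by
  have h1 : E * (1 - E) = 0 := by rw [mul_sub, hE, mul_one, sub_self]
  have h2 : (1 - E) * E = 0 := by rw [sub_mul, hE, one_mul, sub_self]
  have h3 : (1 - E) * (1 - E) = 1 - E := by rw [sub_mul, one_mul, h1, sub_zero]
  have h4 : x * E * (y * E) = x * y * E := by
    rw [mul_assoc, ← mul_assoc E, ← hy.eq, mul_assoc _ E E, hE, mul_assoc]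
  have h5 : x * E * (1 - E) = 0 := by rw [mul_assoc, h1, mul_zero]
  have h6 : (1 - E) * (y * E) = 0 := by rw [hy.eq, ← mul_assoc, h2, zero_mul]
  rw [add_mul, mul_add, mul_add, h3, h4, h5, h6, add_zero, zero_add]

/-- The matrix acts as exp Z on the image of E and as the identity on its kernel. Its determinant
along t ↦ tZ is multiplicative in t with derivative tr(ZE) at 0, hence solves a linear differential
equation. -/
theorem det_exp_mul_add_one_sub {n : ℕ} {Z E : Matrix (Fin n) (Fin n) ℝ} (hZE : Commute Z E)
    (hE : E * E = E) :
    (exp Z * E + (1 - E)).det = Real.exp (Z * E).trace := by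
  set F : ℝ → ℝ := fun t => (exp (t • Z) * E + (1 - E)).det with hF
  have hcomm : ∀ t : ℝ, Commute (exp (t • Z)) E := fun t => (hZE.smul_left t).exp_left
  have hmul : ∀ s t, F (s + t) = F s * F t := by
    intro s t
    simp only [hF]
    rw [← Matrix.det_mul, add_smul, Matrix.exp_add_of_commute _ _
      (((Commute.refl Z).smul_left s).smul_right t)]
    rw [mul_add_one_sub_mul hE (hcomm t)]
  have h0 : F 0 = 1 := by simp [hF]
  have hd0 : HasDerivAt F (Z * E).trace 0 := by
    refine hasDerivAt_det_of_eq_one (by simp) fun i j => ?_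
    simp only [Matrix.add_apply, Matrix.mul_apply]
    refine HasDerivAt.add_const _ (HasDerivAt.fun_sum fun k _ => ?_)
    exact (hasDerivAt_exp_smul_apply Z i k).mul_const _
  have hd : ∀ s, HasDerivAt F ((Z * E).trace * F s) s := by
    intro s
    have h1 : HasDerivAt (fun t => F s * F (t - s)) (F s * (Z * E).trace) s := by
      refine HasDerivAt.const_mul _ ?_
      have := (show HasDerivAt F (Z * E).trace (s - s) by simpa using hd0).comp_sub_const s s
      exact this
    rw [mul_comm]
    refine h1.congr_of_eventuallyEq (Filter.Eventually.of_forall fun t => ?_)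
    simp [← hmul]
  have hconst : ∀ t, HasDerivAt (fun t => F t * Real.exp (-(t * (Z * E).trace))) 0 t := by
    intro t
    have h1 : HasDerivAt (fun t : ℝ => Real.exp (-(t * (Z * E).trace)))
        (Real.exp (-(t * (Z * E).trace)) * -(1 * (Z * E).trace)) t :=
      (((hasDerivAt_id t).mul_const _).neg).exp
    convert! (hd t).mul h1 using 1
    ring
  have := is_const_of_deriv_eq_zero (fun t => (hconst t).differentiableAt)
    (fun t => (hconst t).deriv) 1 0
  simp only [one_mul, h0, zero_mul, neg_zero, Real.exp_zero, mul_one] at this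
  rw [Real.exp_neg, mul_inv_eq_one₀ (Real.exp_pos _).ne'] at this
  simpa [hF] using this

end MatrixLieAlgebra

/-! ### Logarithms of positive definite elements of G. -/

section Polar

open NormedSpace
open scoped Matrix

variable {n : ℕ} {G : Subgroup (GL (Fin n) ℝ)} {𝔤 : Submodule ℝ (Matrix (Fin n) (Fin n) ℝ)}

theorem eq_zero_of_trace_transpose_mul_self {A : Matrix (Fin n) (Fin n) ℝ}
    (h : (Aᵀ * A).trace = 0) : A = 0 := by
  rw [← Matrix.conjTranspose_eq_transpose_of_trivial] at h
  exact Matrix.trace_conjTranspose_mul_self_eq_zero_iff.1 h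

/-- Orthogonal projection for the trace form to a space of matrices stable under transposition. -/
theorem exists_trace_projection (h𝔤 : ∀ X ∈ 𝔤, Xᵀ ∈ 𝔤) (Q : Matrix (Fin n) (Fin n) ℝ) :
    ∃ v ∈ 𝔤, ∀ X ∈ 𝔤, (X * Q).trace = (X * v).trace := by
  let B : 𝔤 →ₗ[ℝ] Module.Dual ℝ 𝔤 := LinearMap.mk₂ ℝ
    (fun v X => ((X : Matrix (Fin n) (Fin n) ℝ) * (v : Matrix (Fin n) (Fin n) ℝ)).trace)
    (fun v v' X => by simp [mul_add]) (fun c v X => by simp)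
    (fun v X X' => by simp [add_mul]) (fun c v X => by simp)
  -- The trace form is nondegenerate on 𝔤: pair v with vᵀ.
  have hinj : Function.Injective B := by
    refine (injective_iff_map_eq_zero B).2 fun v hv => ?_
    have := congrArg (fun L => L (⟨_, h𝔤 _ v.2⟩ : 𝔤)) hv
    exact Subtype.ext (eq_zero_of_trace_transpose_mul_self this)
  have hsurj : Function.Surjective B :=
    (LinearMap.injective_iff_surjective_of_finrank_eq_finrank
      (Subspace.dual_finrank_eq (K := ℝ) (V := 𝔤)).symm).1 hinj
  obtain ⟨v, hv⟩ := hsurj ((Matrix.traceLinearMap (Fin n) ℝ ℝ).comp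
    ((LinearMap.mulRight ℝ Q).comp 𝔤.subtype))
  refine ⟨v, v.2, fun X hX => ?_⟩
  have := congrArg (fun L => L (⟨X, hX⟩ : 𝔤)) hv
  exact this.symm

/-- As Q is symmetric, v and vᵀ represent the same functional on 𝔤. -/
theorem transpose_eq_of_trace_projection (h𝔤 : ∀ X ∈ 𝔤, Xᵀ ∈ 𝔤)
    {Q v : Matrix (Fin n) (Fin n) ℝ} (hQ : Qᵀ = Q) (hv : v ∈ 𝔤)
    (h : ∀ X ∈ 𝔤, (X * Q).trace = (X * v).trace) : vᵀ = v := by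
  have h1 : ∀ X ∈ 𝔤, (X * vᵀ).trace = (X * v).trace := fun X hX => by
    rw [← h X hX, ← Matrix.trace_transpose, Matrix.transpose_mul, Matrix.transpose_transpose,
      Matrix.trace_mul_comm, ← h _ (h𝔤 X hX), ← Matrix.trace_transpose, Matrix.transpose_mul,
      Matrix.transpose_transpose, hQ, Matrix.trace_mul_comm]
  refine sub_eq_zero.1 (eq_zero_of_trace_transpose_mul_self ?_)
  rw [mul_sub, Matrix.trace_sub, h1 _ (h𝔤 _ (𝔤.sub_mem (h𝔤 _ hv) hv)), sub_self]

theorem exists_orthogonal_diagonalization {Y : Matrix (Fin n) (Fin n) ℝ} (hY : Yᵀ = Y) :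
    ∃ (V : Matrix (Fin n) (Fin n) ℝ) (d : Fin n → ℝ), V * Vᵀ = 1 ∧ Vᵀ * V = 1 ∧
      Y = V * Matrix.diagonal d * Vᵀ := by
  have hH : Y.IsHermitian := by
    rw [Matrix.IsHermitian, Matrix.conjTranspose_eq_transpose_of_trivial, hY]
  refine ⟨hH.eigenvectorUnitary, hH.eigenvalues, ?_, ?_, ?_⟩
  · have := Unitary.coe_mul_star_self hH.eigenvectorUnitary
    rwa [Unitary.coe_star, Matrix.star_eq_conjTranspose,
      Matrix.conjTranspose_eq_transpose_of_trivial] at this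
  · have := Unitary.coe_star_mul_self hH.eigenvectorUnitary
    rwa [Matrix.star_eq_conjTranspose,
      Matrix.conjTranspose_eq_transpose_of_trivial] at this
  · have := hH.spectral_theorem
    rwa [Unitary.conjStarAlgAut_apply, Matrix.star_eq_conjTranspose,
      Matrix.conjTranspose_eq_transpose_of_trivial] at this

theorem exp_conj_diagonal {U : Matrix (Fin n) (Fin n) ℝ} (hU : U * Uᵀ = 1) (y : Fin n → ℝ) :
    exp (U * Matrix.diagonal y * Uᵀ) = U * Matrix.diagonal (fun i => Real.exp (y i)) * Uᵀ := by
  have hinv : U⁻¹ = Uᵀ := Matrix.inv_eq_right_inv hU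
  have hunit : IsUnit U := IsUnit.of_mul_eq_one _ hU
  rw [← hinv, Matrix.exp_conj _ _ hunit, Matrix.exp_diagonal]
  congr 3
  funext i
  rw [Pi.coe_exp, Real.exp_eq_exp_ℝ]

theorem orthogonal_conj_mul {V : Matrix (Fin n) (Fin n) ℝ} (hV : Vᵀ * V = 1)
    (A B : Matrix (Fin n) (Fin n) ℝ) : V * A * Vᵀ * (V * B * Vᵀ) = V * (A * B) * Vᵀ := by
  simp only [mul_assoc]
  rw [← mul_assoc Vᵀ V, hV, one_mul]

theorem exists_eq_orthogonal_conj {V : Matrix (Fin n) (Fin n) ℝ} (hV : V * Vᵀ = 1)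
    (x : Matrix (Fin n) (Fin n) ℝ) : ∃ x', x = V * x' * Vᵀ := by
  refine ⟨Vᵀ * x * V, ?_⟩
  simp only [mul_assoc, hV, mul_one]
  rw [← mul_assoc, hV, one_mul]

/-- In an eigenbasis of S, conjugation by S multiplies the (i, j) entry by exp(y i - y j), and
bracketing with log S multiplies it by y i - y j. Interpolating log at these finitely many values
makes the second operator a polynomial in the first, which preserves 𝔤. -/
theorem bracket_log_mem (h : IsReductiveLieAlgebra G 𝔤) {S : GL (Fin n) ℝ} (hS : S ∈ G)
    {U : Matrix (Fin n) (Fin n) ℝ} (hU : U * Uᵀ = 1) (hU' : Uᵀ * U = 1) {y : Fin n → ℝ}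
    (hy : (S : Matrix (Fin n) (Fin n) ℝ) = U * Matrix.diagonal (fun i => Real.exp (y i)) * Uᵀ)
    {Z : Matrix (Fin n) (Fin n) ℝ} (hZ : Z ∈ 𝔤) :
    U * Matrix.diagonal y * Uᵀ * Z - Z * (U * Matrix.diagonal y * Uᵀ) ∈ 𝔤 := by
  have hSinv : ((S⁻¹ : GL (Fin n) ℝ) : Matrix (Fin n) (Fin n) ℝ) =
      U * Matrix.diagonal (fun i => Real.exp (-y i)) * Uᵀ := by
    rw [Matrix.coe_units_inv]
    refine Matrix.inv_eq_right_inv ?_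
    rw [hy, orthogonal_conj_mul hU', Matrix.diagonal_mul_diagonal]
    simp [← Real.exp_add, hU]
  obtain ⟨Z', rfl⟩ := exists_eq_orthogonal_conj hU Z
  let T : ℕ → Matrix (Fin n) (Fin n) ℝ := fun k =>
    U * (Matrix.of fun i j => Real.exp (y i - y j) ^ k * Z' i j) * Uᵀ
  have hT : ∀ k, T k ∈ 𝔤 := by
    intro k
    induction k with
    | zero =>
      convert hZ using 1
      simp only [T, pow_zero, one_mul]
      rfl
    | succ k ih =>
      have h1 := h.conj_mem S hS _ ih
      rw [hy, hSinv, orthogonal_conj_mul hU', orthogonal_conj_mul hU'] at h1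
      convert h1 using 1
      simp only [T]
      congr 2
      ext i j
      rw [Matrix.mul_diagonal, Matrix.diagonal_mul, Matrix.of_apply, Matrix.of_apply, pow_succ,
        sub_eq_add_neg, Real.exp_add]
      ring
  let s : Finset ℝ := Finset.univ.image fun ij : Fin n × Fin n => Real.exp (y ij.1 - y ij.2)
  let p : Polynomial ℝ := Lagrange.interpolate s id Real.log
  have hp : ∀ i j, p.eval (Real.exp (y i - y j)) = y i - y j := by
    intro i j
    have := Lagrange.eval_interpolate_at_node (s := s) (v := id) (i := Real.exp (y i - y j))
      Real.log Function.injective_id.injOn (Finset.mem_image.2 ⟨(i, j), Finset.mem_univ _, rfl⟩)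
    rwa [Real.log_exp] at this
  have hsum : ∑ k ∈ Finset.range (p.natDegree + 1), p.coeff k • T k ∈ 𝔤 :=
    𝔤.sum_mem fun k _ => 𝔤.smul_mem _ (hT k)
  convert hsum using 1
  have h2 : ∑ k ∈ Finset.range (p.natDegree + 1), p.coeff k • T k =
      U * (Matrix.of fun i j => (y i - y j) * Z' i j) * Uᵀ := by
    have h3 : (Matrix.of fun i j => (y i - y j) * Z' i j) =
        ∑ k ∈ Finset.range (p.natDegree + 1),
          p.coeff k • (Matrix.of fun i j => Real.exp (y i - y j) ^ k * Z' i j) := by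
      ext i j
      rw [Matrix.of_apply, ← hp i j, Polynomial.eval_eq_sum_range, Finset.sum_mul,
        Matrix.sum_apply]
      refine Finset.sum_congr rfl fun k _ => ?_
      rw [Matrix.smul_apply, Matrix.of_apply, smul_eq_mul, mul_assoc]
    rw [h3, Finset.mul_sum, Finset.sum_mul]
    refine Finset.sum_congr rfl fun k _ => ?_
    rw [Matrix.mul_smul, Matrix.smul_mul]
  rw [h2]
  have h4 : (Matrix.of fun i j => (y i - y j) * Z' i j) =
      Matrix.diagonal y * Z' - Z' * Matrix.diagonal y := by
    ext i j
    rw [Matrix.sub_apply, Matrix.diagonal_mul, Matrix.mul_diagonal, Matrix.of_apply]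
    ring
  rw [h4, mul_sub, sub_mul, orthogonal_conj_mul hU', orthogonal_conj_mul hU']

theorem commute_conj_diagonal_comp {V x : Matrix (Fin n) (Fin n) ℝ} (hV : V * Vᵀ = 1)
    (hV' : Vᵀ * V = 1) {d : Fin n → ℝ} (g : ℝ → ℝ)
    (h : Commute x (V * Matrix.diagonal d * Vᵀ)) :
    Commute x (V * Matrix.diagonal (fun i => g (d i)) * Vᵀ) := by
  obtain ⟨x', rfl⟩ := exists_eq_orthogonal_conj hV x
  have hinj : ∀ A B : Matrix (Fin n) (Fin n) ℝ, V * A * Vᵀ = V * B * Vᵀ → A = B := by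
    intro A B hAB
    have h1 : ∀ C : Matrix (Fin n) (Fin n) ℝ, Vᵀ * (V * C * Vᵀ) * V = C := fun C => by
      simp only [mul_assoc, hV', mul_one]
      rw [← mul_assoc, hV', one_mul]
    rw [← h1 A, hAB, h1]
  have h2 : x' * Matrix.diagonal d = Matrix.diagonal d * x' := by
    have := h.eq
    rw [orthogonal_conj_mul hV', orthogonal_conj_mul hV'] at this
    exact hinj _ _ this
  have h3 : x' * Matrix.diagonal (fun i => g (d i)) = Matrix.diagonal (fun i => g (d i)) * x' := by
    ext i j
    have h4 := congrFun (congrFun h2 i) j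
    rw [Matrix.mul_diagonal, Matrix.diagonal_mul] at h4 ⊢
    by_cases hij : d i = d j
    · rw [hij, mul_comm]
    · have : x' i j = 0 := by
        have : (d i - d j) * x' i j = 0 := by rw [sub_mul]; linarith
        exact (mul_eq_zero.1 this).resolve_left (sub_ne_zero.2 hij)
      rw [this, mul_zero, zero_mul]
  rw [Commute, SemiconjBy, orthogonal_conj_mul hV', orthogonal_conj_mul hV', h3]

/-- A symmetric matrix orthogonal to `𝔤` and commuting with it vanishes if its exponential lies in
`G`: its eigenspaces are `G`-stable, and the determinants on them give a character of `G`. -/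
theorem eq_zero_of_exp_mem (h : IsReductiveLieAlgebra G 𝔤) {Y : Matrix (Fin n) (Fin n) ℝ}
    (hY : Yᵀ = Y) (hcomm : ∀ Z ∈ 𝔤, Commute Z Y) (htr : ∀ Z ∈ 𝔤, (Z * Y).trace = 0)
    {z : GL (Fin n) ℝ} (hz : z ∈ G) (hzY : (z : Matrix (Fin n) (Fin n) ℝ) = exp Y) : Y = 0 := by
  obtain ⟨V, d, hV, hV', hVd⟩ := exists_orthogonal_diagonalization hY
  -- The spectral projections of Y.
  let E : ℝ → Matrix (Fin n) (Fin n) ℝ := fun a =>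
    V * Matrix.diagonal (fun i => if d i = a then 1 else 0) * Vᵀ
  have hEE : ∀ a, E a * E a = E a := fun a => by
    simp only [E]
    rw [orthogonal_conj_mul hV', Matrix.diagonal_mul_diagonal]
    congr 3
    funext i
    split_ifs <;> simp
  have hEcomm : ∀ a (x : Matrix (Fin n) (Fin n) ℝ), Commute x Y → Commute x (E a) := by
    intro a x hx
    rw [hVd] at hx
    exact commute_conj_diagonal_comp hV hV' (fun t => if t = a then 1 else 0) hx
  let s : Finset ℝ := Finset.univ.image d
  have hsum : ∑ a ∈ s, a • E a = Y := by
    have h1 : Matrix.diagonal d =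
        ∑ a ∈ s, a • Matrix.diagonal (fun i => if d i = a then (1 : ℝ) else 0) := by
      ext i j
      rw [Matrix.sum_apply]
      by_cases hij : i = j
      · subst hij
        simp [s]
      · simp [hij]
    rw [hVd, h1, Finset.mul_sum, Finset.sum_mul]
    refine Finset.sum_congr rfl fun a _ => ?_
    simp only [E]
    rw [Matrix.mul_smul, Matrix.smul_mul]
  -- Each eigenvalue of Y weights the logarithm of the determinant on its eigenspace; `Real.log`
  -- disregards the sign. On the centralizer of Y this is a character with differential Z ↦ tr(ZY),
  -- which vanishes on 𝔤.
  let χ : Matrix (Fin n) (Fin n) ℝ → ℝ := fun x =>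
    ∑ a ∈ s, a * Real.log (x * E a + (1 - E a)).det
  have hdet : ∀ a (x : GL (Fin n) ℝ), Commute (x : Matrix (Fin n) (Fin n) ℝ) Y →
      ((x : Matrix (Fin n) (Fin n) ℝ) * E a + (1 - E a)).det ≠ 0 := by
    intro a x hx h0
    have h1 : Commute ((x⁻¹ : GL (Fin n) ℝ) : Matrix (Fin n) (Fin n) ℝ) Y := hx.units_inv_left
    have h2 := congrArg Matrix.det
      (mul_add_one_sub_mul (x := (x : Matrix (Fin n) (Fin n) ℝ)) (hEE a) (hEcomm a _ h1))
    rw [Matrix.det_mul, h0, zero_mul, Units.mul_inv, one_mul, add_sub_cancel, Matrix.det_one] at h2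
    exact zero_ne_one h2
  have hχmul : ∀ x y : GL (Fin n) ℝ, Commute (x : Matrix (Fin n) (Fin n) ℝ) Y →
      Commute (y : Matrix (Fin n) (Fin n) ℝ) Y → χ (x * y) = χ x + χ y := by
    intro x y hx hy
    simp only [χ]
    rw [← Finset.sum_add_distrib]
    refine Finset.sum_congr rfl fun a _ => ?_
    rw [← mul_add_one_sub_mul (hEE a) (hEcomm a _ hy), Matrix.det_mul,
      Real.log_mul (hdet a x hx) (hdet a y hy), mul_add]
  have hχone : χ 1 = 0 := by simp [χ]
  have hχexp : ∀ Z, Commute Z Y → χ (exp Z) = (Z * Y).trace := by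
    intro Z hZ
    simp only [χ]
    rw [← hsum, Finset.mul_sum, Matrix.trace_sum]
    refine Finset.sum_congr rfl fun a _ => ?_
    rw [det_exp_mul_add_one_sub (hEcomm a Z hZ) (hEE a), Real.log_exp, Matrix.mul_smul,
      Matrix.trace_smul, smul_eq_mul]
  let N : Subgroup (GL (Fin n) ℝ) :=
    { carrier := {x | Commute (x : Matrix (Fin n) (Fin n) ℝ) Y ∧ χ x = 0}
      mul_mem' := by
        rintro x y ⟨hx, hx0⟩ ⟨hy, hy0⟩
        exact ⟨hx.mul_left hy, by rw [Units.val_mul, hχmul x y hx hy, hx0, hy0, add_zero]⟩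
      one_mem' := ⟨Commute.one_left _, hχone⟩
      inv_mem' := by
        rintro x ⟨hx, hx0⟩
        have hx' : Commute ((x⁻¹ : GL (Fin n) ℝ) : Matrix (Fin n) (Fin n) ℝ) Y :=
          hx.units_inv_left
        refine ⟨hx', ?_⟩
        have := hχmul x x⁻¹ hx hx'
        rwa [Units.mul_inv, hχone, hx0, zero_add, eq_comm] at this }
  have hN : G ≤ N := h.generates N fun Z hZ g hg => by
    refine ⟨?_, ?_⟩
    · rw [hg]
      exact (hcomm Z hZ).exp_left
    · rw [hg, hχexp Z (hcomm Z hZ), htr Z hZ]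
  -- Since z = exp Y, this value is tr(Y²).
  have h3 : χ z = 0 := (hN hz).2
  rw [hzY, hχexp Y (Commute.refl Y)] at h3
  refine eq_zero_of_trace_transpose_mul_self ?_
  rwa [hY]

/-- The logarithm of a positive definite element of `G` lies in the Lie algebra. -/
theorem log_mem (h : IsReductiveLieAlgebra G 𝔤) {S : GL (Fin n) ℝ} (hS : S ∈ G)
    {U : Matrix (Fin n) (Fin n) ℝ} (hU : U * Uᵀ = 1) (hU' : Uᵀ * U = 1) {y : Fin n → ℝ}
    (hy : (S : Matrix (Fin n) (Fin n) ℝ) = U * Matrix.diagonal (fun i => Real.exp (y i)) * Uᵀ) :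
    U * Matrix.diagonal y * Uᵀ ∈ 𝔤 := by
  set Y := U * Matrix.diagonal y * Uᵀ with hYdef
  have hYt : Yᵀ = Y := by
    simp [hYdef, Matrix.transpose_mul, mul_assoc]
  obtain ⟨v, hv, hvQ⟩ := exists_trace_projection h.transpose_mem Y
  have hvt := transpose_eq_of_trace_projection h.transpose_mem hYt hv hvQ
  have htr : ∀ Z ∈ 𝔤, (Z * (Y - v)).trace = 0 := fun Z hZ => by
    rw [mul_sub, Matrix.trace_sub, hvQ Z hZ, sub_self]
  -- The bracket of Y - v with Z lies in 𝔤, and its squared norm equals the trace pairing of Y - v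
  -- with another bracket in 𝔤, which is 0.
  have hcomm : ∀ Z ∈ 𝔤, Commute Z (Y - v) := by
    intro Z hZ
    have h1 : (Y - v) * Z - Z * (Y - v) ∈ 𝔤 := by
      have h2 := 𝔤.sub_mem (bracket_log_mem h hS hU hU' hy hZ) (h.bracket_mem v hv Z hZ)
      convert h2 using 1
      simp only [← hYdef]
      noncomm_ring
    have h3 : (Y - v) * Z - Z * (Y - v) = 0 := by
      apply eq_zero_of_trace_transpose_mul_self
      have h4 := h.transpose_mem _ h1
      generalize ((Y - v) * Z - Z * (Y - v))ᵀ = W at h4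
      have h5 := htr _ (h.bracket_mem Z hZ W h4)
      generalize Y - v = D at h5 ⊢
      rw [← h5, sub_mul, mul_sub, Matrix.trace_sub, Matrix.trace_sub, ← mul_assoc, ← mul_assoc,
        Matrix.trace_mul_cycle W D Z]
    exact (sub_eq_zero.1 h3).symm
  have hexp : exp Y = (S : Matrix (Fin n) (Fin n) ℝ) := by rw [hy, exp_conj_diagonal hU]
  obtain ⟨z, hz⟩ := Matrix.isUnit_exp (Y - v)
  obtain ⟨w, hw⟩ := Matrix.isUnit_exp v
  have hwG : w ∈ G := h.exp_mem v hv w hw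
  have hSzw : S = z * w := Units.ext <| by
    rw [Units.val_mul, hz, hw, ← Matrix.exp_add_of_commute _ _ (hcomm v hv).symm, sub_add_cancel,
      hexp]
  have hzG : z ∈ G := by
    have : z = S * w⁻¹ := by rw [hSzw, mul_inv_cancel_right]
    rw [this]
    exact G.mul_mem hS (G.inv_mem hwG)
  have h0 := eq_zero_of_exp_mem h (Y := Y - v) (by rw [Matrix.transpose_sub, hYt, hvt]) hcomm htr
    hzG hz
  rw [sub_eq_zero.1 h0]
  exact hv

end Polar

/-! ### The gradient of the logarithmic size and its behaviour under conjugation. -/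

section Gradient

open NormedSpace
open scoped Matrix

variable {n : ℕ} {G : Subgroup (GL (Fin n) ℝ)} {𝔤 : Submodule ℝ (Matrix (Fin n) (Fin n) ℝ)}

/-- A logarithmic size on the general linear group. -/
noncomputable def logSize (x : GL (Fin n) ℝ) : ℝ :=
  Real.log (1 + ((x : Matrix (Fin n) (Fin n) ℝ)ᵀ * (x : Matrix (Fin n) (Fin n) ℝ)).trace +
    (((x⁻¹ : GL (Fin n) ℝ) : Matrix (Fin n) (Fin n) ℝ)ᵀ *
      ((x⁻¹ : GL (Fin n) ℝ) : Matrix (Fin n) (Fin n) ℝ)).trace)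

theorem trace_transpose_mul_self (A : Matrix (Fin n) (Fin n) ℝ) :
    (Aᵀ * A).trace = ∑ j, ∑ i, A i j ^ 2 := by
  simp [Matrix.trace, Matrix.mul_apply, sq]

theorem trace_transpose_mul_self_nonneg (A : Matrix (Fin n) (Fin n) ℝ) : 0 ≤ (Aᵀ * A).trace := by
  rw [trace_transpose_mul_self]
  positivity

theorem trace_mul_sq_le (A B : Matrix (Fin n) (Fin n) ℝ) :
    (Aᵀ * B).trace ^ 2 ≤ (Aᵀ * A).trace * (Bᵀ * B).trace := by
  have h : ∀ A B : Matrix (Fin n) (Fin n) ℝ,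
      (Aᵀ * B).trace = ∑ p : Fin n × Fin n, A p.2 p.1 * B p.2 p.1 := fun A B => by
    simp [Matrix.trace, Matrix.mul_apply, Fintype.sum_prod_type]
  rw [h, h A A, h B B]
  simp only [← sq]
  exact Finset.sum_mul_sq_le_sq_mul_sq _ _ _

/-- Expand ‖A - Aᵀ‖² ≥ 0. The left side is conjugation invariant, which is what makes the descent
uniform in γ. -/
theorem trace_mul_self_le (A : Matrix (Fin n) (Fin n) ℝ) : (A * A).trace ≤ (Aᵀ * A).trace := by
  have h := trace_transpose_mul_self_nonneg (A - Aᵀ)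
  have h1 : (Aᵀ * Aᵀ).trace = (A * A).trace := by
    rw [← Matrix.transpose_mul, Matrix.trace_transpose]
  simp only [Matrix.transpose_sub, Matrix.transpose_transpose, sub_mul, mul_sub,
    Matrix.trace_sub, Matrix.trace_mul_comm A Aᵀ, h1] at h
  linarith

theorem exists_symmetric_log (x : GL (Fin n) ℝ) :
    ∃ (U : Matrix (Fin n) (Fin n) ℝ) (y : Fin n → ℝ), U * Uᵀ = 1 ∧ Uᵀ * U = 1 ∧
      (x : Matrix (Fin n) (Fin n) ℝ) * (x : Matrix (Fin n) (Fin n) ℝ)ᵀ =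
        U * Matrix.diagonal (fun i => Real.exp (y i)) * Uᵀ ∧
      ((x⁻¹ : GL (Fin n) ℝ) : Matrix (Fin n) (Fin n) ℝ)ᵀ *
          ((x⁻¹ : GL (Fin n) ℝ) : Matrix (Fin n) (Fin n) ℝ) =
        U * Matrix.diagonal (fun i => Real.exp (-y i)) * Uᵀ := by
  set A := (x : Matrix (Fin n) (Fin n) ℝ) with hA
  set B := ((x⁻¹ : GL (Fin n) ℝ) : Matrix (Fin n) (Fin n) ℝ) with hB
  have hAB : A * B = 1 := Units.mul_inv x
  have hBA : B * A = 1 := Units.inv_mul x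
  obtain ⟨U, d, hU, hU', hd⟩ := exists_orthogonal_diagonalization (Y := A * Aᵀ)
    (by rw [Matrix.transpose_mul, Matrix.transpose_transpose])
  have hdiag : Matrix.diagonal d = (Aᵀ * U)ᵀ * (Aᵀ * U) := by
    rw [Matrix.transpose_mul, Matrix.transpose_transpose, mul_assoc, ← mul_assoc A, hd]
    simp only [mul_assoc, hU', mul_one]
    rw [← mul_assoc, hU', one_mul]
  have hdi : ∀ i, d i = ∑ k, (Aᵀ * U) k i ^ 2 := fun i => by
    have := congrFun (congrFun hdiag i) i
    rw [Matrix.diagonal_apply_eq, Matrix.mul_apply] at this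
    rw [this]
    exact Finset.sum_congr rfl fun k _ => by rw [Matrix.transpose_apply, sq]
  have hinvl : (Uᵀ * Bᵀ) * (Aᵀ * U) = 1 := by
    rw [mul_assoc, ← mul_assoc Bᵀ, ← Matrix.transpose_mul, hAB, Matrix.transpose_one, one_mul, hU']
  -- Each d i is the squared norm of a column of the invertible matrix AᵀU.
  have hpos : ∀ i, 0 < d i := by
    intro i
    rw [hdi]
    refine lt_of_le_of_ne (Finset.sum_nonneg fun k _ => sq_nonneg _) fun h0 => ?_
    have h1 : ∀ k, (Aᵀ * U) k i = 0 := fun k => by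
      have := (Finset.sum_eq_zero_iff_of_nonneg fun k _ => sq_nonneg ((Aᵀ * U) k i)).1 h0.symm k
        (Finset.mem_univ k)
      exact pow_eq_zero_iff (two_ne_zero) |>.1 this
    have h2 := congrFun (congrFun hinvl i) i
    rw [Matrix.mul_apply] at h2
    simp [h1] at h2
  have hexp : (fun i => Real.exp (Real.log (d i))) = d := funext fun i => Real.exp_log (hpos i)
  refine ⟨U, fun i => Real.log (d i), hU, hU', by rw [hexp, hd], ?_⟩
  have h3 : (U * Matrix.diagonal (fun i => Real.exp (-Real.log (d i))) * Uᵀ) * (A * Aᵀ) = 1 := by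
    rw [hd, orthogonal_conj_mul hU', Matrix.diagonal_mul_diagonal]
    have : (fun i => Real.exp (-Real.log (d i)) * d i) = fun _ => 1 := funext fun i => by
      rw [Real.exp_neg, Real.exp_log (hpos i), inv_mul_cancel₀ (hpos i).ne']
    rw [this, Matrix.diagonal_one, mul_one, hU]
  have h4 : (A * Aᵀ) * (Bᵀ * B) = 1 := by
    rw [mul_assoc, ← mul_assoc Aᵀ, ← Matrix.transpose_mul, hBA, Matrix.transpose_one, one_mul, hAB]
  exact (left_inv_eq_right_inv h3 h4).symm

/-- Let M = max |y i|. Beyond the threshold M ≥ 1, so the numerator is at least M exp(M) / 2, while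
the denominator is at most (2n + 1) exp(M) and ∑ y i ^ 2 at most n M². -/
theorem exists_lower_bound_sinh_pairing (n : ℕ) : ∃ c > 0, ∃ R : ℝ, ∀ y : Fin n → ℝ,
    R < Real.log (1 + ∑ i, Real.exp (y i) + ∑ i, Real.exp (-y i)) →
      c * ∑ i, y i ^ 2 ≤ ((∑ i, y i * (Real.exp (y i) - Real.exp (-y i))) /
        (1 + ∑ i, Real.exp (y i) + ∑ i, Real.exp (-y i))) ^ 2 ∧ 0 < ∑ i, y i ^ 2 := by
  refine ⟨((2 * (n + 1) * (2 * n + 1) : ℝ) ^ 2)⁻¹, by positivity,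
    Real.log (1 + n * Real.exp 1 + n * Real.exp 1), fun y hy => ?_⟩
  have hq : 0 < 1 + ∑ i, Real.exp (y i) + ∑ i, Real.exp (-y i) := by positivity
  have hlt := (Real.log_lt_log_iff (by positivity) hq).1 hy
  have hex : ∃ i, 1 ≤ |y i| := by
    by_contra! hcon
    have h1 : ∑ i, Real.exp (y i) ≤ n * Real.exp 1 := by
      simpa using Finset.sum_le_card_nsmul Finset.univ (fun i => Real.exp (y i)) (Real.exp 1)
        fun i _ => Real.exp_le_exp.2 ((le_abs_self _).trans (hcon i).le)
    have h2 : ∑ i, Real.exp (-y i) ≤ n * Real.exp 1 := by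
      simpa using Finset.sum_le_card_nsmul Finset.univ (fun i => Real.exp (-y i)) (Real.exp 1)
        fun i _ => Real.exp_le_exp.2 ((neg_le_abs _).trans (hcon i).le)
    linarith
  obtain ⟨i₀, hi₀⟩ := hex
  obtain ⟨m, -, hm⟩ := Finset.exists_max_image Finset.univ (fun i => |y i|) ⟨i₀, Finset.mem_univ _⟩
  set M := |y m| with hM
  have hM1 : 1 ≤ M := hi₀.trans (hm i₀ (Finset.mem_univ _))
  have hle : ∀ i, |y i| ≤ M := fun i => hm i (Finset.mem_univ _)
  have hq_le : 1 + ∑ i, Real.exp (y i) + ∑ i, Real.exp (-y i) ≤ (2 * n + 1) * Real.exp M := by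
    have h1 : ∑ i, Real.exp (y i) ≤ n * Real.exp M := by
      simpa using Finset.sum_le_card_nsmul Finset.univ (fun i => Real.exp (y i)) (Real.exp M)
        fun i _ => Real.exp_le_exp.2 ((le_abs_self _).trans (hle i))
    have h2 : ∑ i, Real.exp (-y i) ≤ n * Real.exp M := by
      simpa using Finset.sum_le_card_nsmul Finset.univ (fun i => Real.exp (-y i)) (Real.exp M)
        fun i _ => Real.exp_le_exp.2 ((neg_le_abs _).trans (hle i))
    have h3 : 1 ≤ Real.exp M := Real.one_le_exp (by linarith)
    linarith
  have hterm : ∀ t : ℝ, t * (Real.exp t - Real.exp (-t)) =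
      |t| * (Real.exp |t| - Real.exp (-|t|)) := fun t => by
    rcases abs_cases t with ⟨h, -⟩ | ⟨h, -⟩
    · rw [h]
    · rw [h, neg_neg]; ring
  have hnum : M * (Real.exp M / 2) ≤ ∑ i, y i * (Real.exp (y i) - Real.exp (-y i)) := by
    have h1 : y m * (Real.exp (y m) - Real.exp (-y m)) ≤
        ∑ i, y i * (Real.exp (y i) - Real.exp (-y i)) := by
      refine Finset.single_le_sum (f := fun i => y i * (Real.exp (y i) - Real.exp (-y i)))
        (fun i _ => ?_) (Finset.mem_univ m)
      simp only [hterm (y i)]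
      refine mul_nonneg (abs_nonneg _) (sub_nonneg.2 (Real.exp_le_exp.2 ?_))
      linarith [abs_nonneg (y i)]
    rw [hterm (y m), ← hM] at h1
    refine le_trans (mul_le_mul_of_nonneg_left ?_ (by linarith)) h1
    have h2 : 2 ≤ Real.exp M := by linarith [Real.add_one_le_exp M]
    have h3 : Real.exp (-M) ≤ 1 := Real.exp_le_one_iff.2 (by linarith)
    linarith
  have hsq : ∑ i, y i ^ 2 ≤ n * M ^ 2 := by
    simpa using Finset.sum_le_card_nsmul Finset.univ (fun i => y i ^ 2) (M ^ 2)
      fun i _ => sq_le_sq.2 (by rw [abs_of_nonneg (by linarith : 0 ≤ M)]; exact hle i)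
  have hsqpos : 0 < ∑ i, y i ^ 2 := by
    have h1 : y m ^ 2 ≤ ∑ i, y i ^ 2 :=
      Finset.single_le_sum (f := fun i => y i ^ 2) (fun i _ => sq_nonneg _) (Finset.mem_univ m)
    rw [← sq_abs, ← hM] at h1
    nlinarith
  refine ⟨?_, hsqpos⟩
  have hquot : M / (2 * (2 * n + 1)) ≤ (∑ i, y i * (Real.exp (y i) - Real.exp (-y i))) /
        (1 + ∑ i, Real.exp (y i) + ∑ i, Real.exp (-y i)) := by
    rw [le_div_iff₀ hq]
    refine le_trans ?_ hnum
    calc M / (2 * (2 * n + 1)) * (1 + ∑ i, Real.exp (y i) + ∑ i, Real.exp (-y i))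
        ≤ M / (2 * (2 * n + 1)) * ((2 * n + 1) * Real.exp M) := by
          gcongr
      _ = M * (Real.exp M / 2) := by field_simp
  calc ((2 * (n + 1) * (2 * n + 1) : ℝ) ^ 2)⁻¹ * ∑ i, y i ^ 2
      ≤ ((2 * (n + 1) * (2 * n + 1) : ℝ) ^ 2)⁻¹ * ((n + 1) ^ 2 * M ^ 2) := by
        gcongr
        refine hsq.trans (mul_le_mul_of_nonneg_right ?_ (sq_nonneg _))
        nlinarith [(Nat.cast_nonneg n : (0 : ℝ) ≤ n)]
    _ = (M / (2 * (2 * n + 1))) ^ 2 := by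
        field_simp
    _ ≤ _ := by
        gcongr

theorem hasDerivAt_mul_apply {A B : ℝ → Matrix (Fin n) (Fin n) ℝ}
    {A' B' : Matrix (Fin n) (Fin n) ℝ} {t : ℝ} (hA : ∀ i j, HasDerivAt (fun s => A s i j) (A' i j) t)
    (hB : ∀ i j, HasDerivAt (fun s => B s i j) (B' i j) t) (i j : Fin n) :
    HasDerivAt (fun s => (A s * B s) i j) ((A' * B t + A t * B') i j) t := by
  simp only [Matrix.mul_apply, Matrix.add_apply, ← Finset.sum_add_distrib]
  exact HasDerivAt.fun_sum fun k _ => (hA i k).mul (hB k j)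

theorem hasDerivAt_trace_transpose_mul_self {A : ℝ → Matrix (Fin n) (Fin n) ℝ}
    {A' : Matrix (Fin n) (Fin n) ℝ} {t : ℝ}
    (hA : ∀ i j, HasDerivAt (fun s => A s i j) (A' i j) t) :
    HasDerivAt (fun s => ((A s)ᵀ * A s).trace) (2 * (A' * (A t)ᵀ).trace) t := by
  have h : HasDerivAt (fun s => ((A s)ᵀ * A s).trace) (A'ᵀ * A t + (A t)ᵀ * A').trace t := by
    simp only [Matrix.trace, Matrix.diag]
    exact HasDerivAt.fun_sum fun i _ => hasDerivAt_mul_apply (fun i j => hA j i) hA i i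
  convert! h using 1
  rw [Matrix.trace_add, ← Matrix.trace_transpose (A'ᵀ * A t), Matrix.transpose_mul,
    Matrix.transpose_transpose, Matrix.trace_mul_comm A']
  ring

theorem trace_conj_mul_sub (C D A B w : Matrix (Fin n) (Fin n) ℝ) :
    2 * (C * w * D * (A * Aᵀ - Bᵀ * B)).trace =
      2 * (C * w * D * A * Aᵀ).trace + 2 * (B * C * -w * D * Bᵀ).trace := by
  have h : (B * C * -w * D * Bᵀ).trace = -(C * w * D * (Bᵀ * B)).trace := by
    rw [← mul_assoc (C * w * D), Matrix.trace_mul_comm _ B, ← Matrix.trace_neg]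
    simp only [mul_assoc, neg_mul, mul_neg]
  rw [h, mul_sub, Matrix.trace_sub, ← mul_assoc (C * w * D) A]
  ring

/-- The derivative of `logSize` along a left translation flow. -/
theorem hasDerivAt_logSize (x γ : GL (Fin n) ℝ) (w : Matrix (Fin n) (Fin n) ℝ)
    {e : ℝ → GL (Fin n) ℝ} (he : ∀ t, (e t : Matrix (Fin n) (Fin n) ℝ) = exp (t • w)) :
    HasDerivAt (fun t => logSize (γ * e t * γ⁻¹ * x))
      (2 * (((γ : Matrix (Fin n) (Fin n) ℝ) * w * ((γ⁻¹ : GL (Fin n) ℝ) : Matrix _ _ ℝ)) *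
        ((x : Matrix (Fin n) (Fin n) ℝ) * (x : Matrix (Fin n) (Fin n) ℝ)ᵀ -
          ((x⁻¹ : GL (Fin n) ℝ) : Matrix (Fin n) (Fin n) ℝ)ᵀ *
          ((x⁻¹ : GL (Fin n) ℝ) : Matrix (Fin n) (Fin n) ℝ))).trace /
        (1 + ((x : Matrix (Fin n) (Fin n) ℝ)ᵀ * (x : Matrix (Fin n) (Fin n) ℝ)).trace +
    (((x⁻¹ : GL (Fin n) ℝ) : Matrix (Fin n) (Fin n) ℝ)ᵀ *
      ((x⁻¹ : GL (Fin n) ℝ) : Matrix (Fin n) (Fin n) ℝ)).trace)) 0 := by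
  have he0 : e 0 = 1 := Units.ext (by rw [he, zero_smul, exp_zero, Units.val_one])
  have heinv : ∀ t, (((e t)⁻¹ : GL (Fin n) ℝ) : Matrix (Fin n) (Fin n) ℝ) = exp (t • (-w)) :=
    fun t => by rw [Matrix.coe_units_inv, he, smul_neg, Matrix.exp_neg]
  have hconst : ∀ (C : Matrix (Fin n) (Fin n) ℝ) (i j : Fin n),
      HasDerivAt (fun _ : ℝ => C i j) ((0 : Matrix (Fin n) (Fin n) ℝ) i j) 0 :=
    fun C i j => hasDerivAt_const _ _
  have h1 := hasDerivAt_trace_transpose_mul_self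
    (hasDerivAt_mul_apply (hasDerivAt_mul_apply (hconst (γ : Matrix (Fin n) (Fin n) ℝ))
      (hasDerivAt_exp_smul_apply w))
      (hconst (((γ⁻¹ : GL (Fin n) ℝ) : Matrix (Fin n) (Fin n) ℝ) * (x : Matrix (Fin n) (Fin n) ℝ))))
  have h2 := hasDerivAt_trace_transpose_mul_self
    (hasDerivAt_mul_apply (hasDerivAt_mul_apply (hconst
      (((x⁻¹ : GL (Fin n) ℝ) : Matrix (Fin n) (Fin n) ℝ) * (γ : Matrix (Fin n) (Fin n) ℝ)))
      (hasDerivAt_exp_smul_apply (-w)))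
      (hconst ((γ⁻¹ : GL (Fin n) ℝ) : Matrix (Fin n) (Fin n) ℝ)))
  have h3 := ((h1.const_add 1).add h2).log (by
    have := trace_transpose_mul_self_nonneg
      ((γ : Matrix (Fin n) (Fin n) ℝ) * exp ((0 : ℝ) • w) *
        (((γ⁻¹ : GL (Fin n) ℝ) : Matrix (Fin n) (Fin n) ℝ) * (x : Matrix (Fin n) (Fin n) ℝ)))
    have := trace_transpose_mul_self_nonneg
      (((x⁻¹ : GL (Fin n) ℝ) : Matrix (Fin n) (Fin n) ℝ) * (γ : Matrix (Fin n) (Fin n) ℝ) *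
        exp ((0 : ℝ) • (-w)) * ((γ⁻¹ : GL (Fin n) ℝ) : Matrix (Fin n) (Fin n) ℝ))
    simp only [Pi.add_apply]
    positivity)
  have hγ : (γ : Matrix (Fin n) (Fin n) ℝ) * ((γ⁻¹ : GL (Fin n) ℝ) : Matrix (Fin n) (Fin n) ℝ) = 1 :=
    Units.mul_inv γ
  convert! h3 using 1
  · funext t
    simp only [logSize, Pi.add_apply, mul_inv_rev, inv_inv, Units.val_mul, he, heinv, mul_assoc]
  · have hr : ∀ B : Matrix (Fin n) (Fin n) ℝ, B * (γ : Matrix (Fin n) (Fin n) ℝ) *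
        ((γ⁻¹ : GL (Fin n) ℝ) : Matrix (Fin n) (Fin n) ℝ) = B := fun B => by
      rw [mul_assoc, hγ, mul_one]
    simp only [Pi.add_apply, zero_smul, exp_zero, mul_one, zero_add, mul_zero, add_zero,
      ← mul_assoc, hγ, one_mul, hr]
    rw [trace_conj_mul_sub]

/-- Outside a compact set, `logSize` has a definite slope in some direction of the Lie algebra, even
after conjugation by an arbitrary element of the group. -/
theorem exists_descent_direction (h : IsReductiveLieAlgebra G 𝔤)
    (hT : ∀ g ∈ G, ∃ g' ∈ G, (g' : Matrix (Fin n) (Fin n) ℝ) = (g : Matrix (Fin n) (Fin n) ℝ)ᵀ) :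
    ∃ c > 0, ∃ R : ℝ, ∀ x ∈ G, R < logSize x → ∀ γ ∈ G, ∃ w ∈ 𝔤, (wᵀ * w).trace = 1 ∧
      ∀ e : ℝ → GL (Fin n) ℝ, (∀ t, (e t : Matrix (Fin n) (Fin n) ℝ) = exp (t • w)) →
        ∃ D ≤ -c, HasDerivAt (fun t => logSize (γ * e t * γ⁻¹ * x)) D 0 := by
  obtain ⟨c, hc, R, hR⟩ := exists_lower_bound_sinh_pairing n
  refine ⟨2 * √c, by positivity, R, fun x hx hxR γ hγ => ?_⟩
  obtain ⟨U, y, hU, hU', hxx, hxx'⟩ := exists_symmetric_log x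
  set A := (x : Matrix (Fin n) (Fin n) ℝ) with hA
  set B := ((x⁻¹ : GL (Fin n) ℝ) : Matrix (Fin n) (Fin n) ℝ) with hB
  set g := (γ : Matrix (Fin n) (Fin n) ℝ) with hg
  set g' := ((γ⁻¹ : GL (Fin n) ℝ) : Matrix (Fin n) (Fin n) ℝ) with hg'
  have hgg' : g * g' = 1 := Units.mul_inv γ
  have htrU : ∀ d : Fin n → ℝ, (U * Matrix.diagonal d * Uᵀ).trace = ∑ i, d i := fun d => by
    rw [Matrix.trace_mul_cycle, hU', one_mul, Matrix.trace_diagonal]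
  have htr1 : (Aᵀ * A).trace = ∑ i, Real.exp (y i) := by
    rw [Matrix.trace_mul_comm, hxx, htrU]
  have htr2 : (Bᵀ * B).trace = ∑ i, Real.exp (-y i) := by rw [hxx', htrU]
  set q := 1 + ∑ i, Real.exp (y i) + ∑ i, Real.exp (-y i) with hq
  have hlog : logSize x = Real.log q := by
    simp only [logSize, ← hA, ← hB, htr1, htr2, hq]
  obtain ⟨hR1, hR2⟩ := hR y (hlog ▸ hxR)
  obtain ⟨xt, hxt, hxtv⟩ := hT x hx
  have hY : U * Matrix.diagonal y * Uᵀ ∈ 𝔤 :=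
    log_mem h (S := x * xt) (G.mul_mem hx hxt) hU hU' (by rw [Units.val_mul, hxtv, ← hxx])
  set Y := U * Matrix.diagonal y * Uᵀ with hYdef
  set Q := q⁻¹ • (A * Aᵀ - Bᵀ * B) with hQ
  have hQt : Qᵀ = Q := by
    simp [hQ, Matrix.transpose_smul, Matrix.transpose_sub, Matrix.transpose_mul]
  obtain ⟨v, hv, hvQ⟩ := exists_trace_projection h.transpose_mem Q
  have hvt := transpose_eq_of_trace_projection h.transpose_mem hQt hv hvQ
  have hYt : Yᵀ = Y := by simp [hYdef, Matrix.transpose_mul, mul_assoc]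
  have hYY : (Yᵀ * Y).trace = ∑ i, y i ^ 2 := by
    rw [hYt, hYdef, orthogonal_conj_mul hU', Matrix.diagonal_mul_diagonal, htrU]
    simp only [sq]
  have hYQ : (Yᵀ * v).trace =
      (∑ i, y i * (Real.exp (y i) - Real.exp (-y i))) / q := by
    rw [hYt, ← hvQ Y hY, hQ, Matrix.mul_smul, Matrix.trace_smul, hxx, hxx', ← sub_mul, ← mul_sub,
      Matrix.diagonal_sub, hYdef, orthogonal_conj_mul hU', Matrix.diagonal_mul_diagonal, htrU,
      smul_eq_mul, div_eq_inv_mul]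
  -- Cauchy–Schwarz against Y turns the lower bound on the pairing into one on the gradient.
  have hvv : c ≤ (vᵀ * v).trace := by
    have h1 := trace_mul_sq_le Y v
    rw [hYQ, hYY] at h1
    have h2 := hR1.trans h1
    rw [mul_comm] at h2
    exact le_of_mul_le_mul_left h2 hR2
  set u := g' * v * g with hu
  have hu𝔤 : u ∈ 𝔤 := by
    have := h.conj_mem γ⁻¹ (G.inv_mem hγ) v hv
    rwa [inv_inv] at this
  have huu : c ≤ (uᵀ * u).trace := by
    refine hvv.trans (le_trans (le_of_eq ?_) (trace_mul_self_le u))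
    rw [hvt, hu]
    have : g' * v * g * (g' * v * g) = g' * (v * v) * g := by
      simp only [mul_assoc]
      rw [← mul_assoc g g', hgg', one_mul]
    rw [this, Matrix.trace_mul_cycle, hgg', one_mul]
  set r := √(uᵀ * u).trace with hr
  have hrpos : 0 < r := Real.sqrt_pos.2 (hc.trans_le huu)
  have hrr : r * r = (uᵀ * u).trace := Real.mul_self_sqrt (hc.le.trans huu)
  -- The normalized direction of steepest descent: the derivative is 2 tr(wu) = -2r, with r ≥ √c.
  refine ⟨-(r⁻¹ • uᵀ), 𝔤.neg_mem (𝔤.smul_mem _ (h.transpose_mem u hu𝔤)), ?_, fun e he => ?_⟩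
  · rw [Matrix.transpose_neg, neg_mul_neg, Matrix.transpose_smul, Matrix.transpose_transpose,
      Matrix.smul_mul, Matrix.mul_smul, Matrix.trace_smul, Matrix.trace_smul,
      Matrix.trace_mul_comm, ← hrr, smul_eq_mul, smul_eq_mul]
    field_simp
  · refine ⟨_, ?_, hasDerivAt_logSize x γ _ he⟩
    simp only [← hA, ← hB, ← hg, ← hg']
    rw [htr1, htr2, ← hq]
    set w := -(r⁻¹ • uᵀ) with hw
    have hw𝔤 : g * w * g' ∈ 𝔤 := h.conj_mem γ hγ w
      (𝔤.neg_mem (𝔤.smul_mem _ (h.transpose_mem u hu𝔤)))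
    have h1 : (g * w * g' * (A * Aᵀ - Bᵀ * B)).trace / q = (g * w * g' * Q).trace := by
      rw [hQ, Matrix.mul_smul, Matrix.trace_smul, smul_eq_mul, div_eq_inv_mul]
    have h2 : (g * w * g' * v).trace = (w * u).trace := by
      rw [hu, mul_assoc g, mul_assoc g, Matrix.trace_mul_comm]
      simp only [mul_assoc]
    have h3 : (w * u).trace = -r := by
      rw [hw, neg_mul, Matrix.smul_mul, Matrix.trace_neg, Matrix.trace_smul, ← hrr, smul_eq_mul,
        inv_mul_cancel_left₀ hrpos.ne']
    rw [mul_div_assoc, h1, hvQ _ hw𝔤, h2, h3]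
    have : √c ≤ r := Real.sqrt_le_sqrt huu
    linarith

end Gradient

/-! ### Properness of the size and the uniform descent step. -/

section Descent

open NormedSpace Filter
open scoped Matrix

variable {n : ℕ} {G : Subgroup (GL (Fin n) ℝ)} {𝔤 : Submodule ℝ (Matrix (Fin n) (Fin n) ℝ)}

theorem continuous_logSize : Continuous (logSize : GL (Fin n) ℝ → ℝ) := by
  have h1 : Continuous fun x : GL (Fin n) ℝ => (x : Matrix (Fin n) (Fin n) ℝ) :=
    Units.continuous_val
  have h2 : Continuous fun x : GL (Fin n) ℝ =>
      ((x⁻¹ : GL (Fin n) ℝ) : Matrix (Fin n) (Fin n) ℝ) := h1.comp continuous_inv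
  refine Continuous.log ?_ fun x => ?_
  · exact (continuous_const.add (h1.matrix_transpose.matrix_mul h1).matrix_trace).add
      (h2.matrix_transpose.matrix_mul h2).matrix_trace
  · have := trace_transpose_mul_self_nonneg (x : Matrix (Fin n) (Fin n) ℝ)
    have := trace_transpose_mul_self_nonneg ((x⁻¹ : GL (Fin n) ℝ) : Matrix (Fin n) (Fin n) ℝ)
    positivity

theorem logSize_nonneg (x : GL (Fin n) ℝ) : 0 ≤ logSize x := by
  have := trace_transpose_mul_self_nonneg (x : Matrix (Fin n) (Fin n) ℝ)
  have := trace_transpose_mul_self_nonneg ((x⁻¹ : GL (Fin n) ℝ) : Matrix (Fin n) (Fin n) ℝ)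
  exact Real.log_nonneg (by linarith)

section
open scoped Matrix.Norms.Frobenius

theorem frobenius_norm_sq (A : Matrix (Fin n) (Fin n) ℝ) : ‖A‖ ^ 2 = (Aᵀ * A).trace := by
  rw [Matrix.frobenius_norm_def, ← Real.sqrt_eq_rpow, Real.sq_sqrt (by positivity),
    trace_transpose_mul_self, Finset.sum_comm]
  simp

theorem trace_transpose_mul_self_mul_le (A B : Matrix (Fin n) (Fin n) ℝ) :
    ((A * B)ᵀ * (A * B)).trace ≤ (Aᵀ * A).trace * (Bᵀ * B).trace := by
  rw [← frobenius_norm_sq, ← frobenius_norm_sq, ← frobenius_norm_sq, ← mul_pow]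
  exact pow_le_pow_left₀ (norm_nonneg _) (norm_mul_le A B) 2

end

/-- Submultiplicativity of the Frobenius norm, with (1 + a + b)(1 + c + d) ≥ 1 + ac + bd. -/
theorem logSize_mul_le (x y : GL (Fin n) ℝ) : logSize (x * y) ≤ logSize x + logSize y := by
  have h1 := trace_transpose_mul_self_nonneg (x : Matrix (Fin n) (Fin n) ℝ)
  have h2 := trace_transpose_mul_self_nonneg ((x⁻¹ : GL (Fin n) ℝ) : Matrix (Fin n) (Fin n) ℝ)
  have h3 := trace_transpose_mul_self_nonneg (y : Matrix (Fin n) (Fin n) ℝ)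
  have h4 := trace_transpose_mul_self_nonneg ((y⁻¹ : GL (Fin n) ℝ) : Matrix (Fin n) (Fin n) ℝ)
  have h5 := trace_transpose_mul_self_mul_le (x : Matrix (Fin n) (Fin n) ℝ) y
  have h6 := trace_transpose_mul_self_mul_le ((y⁻¹ : GL (Fin n) ℝ) : Matrix (Fin n) (Fin n) ℝ)
    ((x⁻¹ : GL (Fin n) ℝ) : Matrix (Fin n) (Fin n) ℝ)
  have h7 := trace_transpose_mul_self_nonneg
    ((x : Matrix (Fin n) (Fin n) ℝ) * (y : Matrix (Fin n) (Fin n) ℝ))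
  have h8 := trace_transpose_mul_self_nonneg (((y⁻¹ : GL (Fin n) ℝ) : Matrix (Fin n) (Fin n) ℝ) *
    ((x⁻¹ : GL (Fin n) ℝ) : Matrix (Fin n) (Fin n) ℝ))
  simp only [logSize]
  rw [← Real.log_mul (by positivity) (by positivity)]
  refine Real.log_le_log ?_ ?_
  · rw [mul_inv_rev, Units.val_mul, Units.val_mul]
    positivity
  · rw [mul_inv_rev, Units.val_mul, Units.val_mul]
    nlinarith [mul_nonneg h1 h4, mul_nonneg h2 h3]

-- Bounded size bounds both x and x⁻¹, and units are the closed set of pairs with AB = BA = 1.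
open scoped Matrix.Norms.Frobenius in
theorem isCompact_logSize_le (R : ℝ) : IsCompact {x : GL (Fin n) ℝ | logSize x ≤ R} := by
  have : ProperSpace (Matrix (Fin n) (Fin n) ℝ) := FiniteDimensional.proper ℝ _
  set b : ℝ := √(Real.exp R)
  let K : Set (Matrix (Fin n) (Fin n) ℝ × Matrix (Fin n) (Fin n) ℝ) :=
    (Metric.closedBall 0 b ×ˢ Metric.closedBall 0 b) ∩ {p | p.1 * p.2 = 1 ∧ p.2 * p.1 = 1}
  have hK : IsCompact K := ((isCompact_closedBall _ _).prod (isCompact_closedBall _ _)).inter_right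
    ((isClosed_eq (continuous_fst.mul continuous_snd) continuous_const).inter
      (isClosed_eq (continuous_snd.mul continuous_fst) continuous_const))
  have hK' : IsCompact ((fun p : Matrix (Fin n) (Fin n) ℝ × Matrix (Fin n) (Fin n) ℝ =>
      (p.1, MulOpposite.op p.2)) '' K) :=
    hK.image (continuous_fst.prodMk (MulOpposite.continuous_op.comp continuous_snd))
  have hpre := Units.isInducing_embedProduct.isCompact_preimage' hK' (by
    rintro _ ⟨p, ⟨-, hp1, hp2⟩, rfl⟩
    exact ⟨⟨p.1, p.2, hp1, hp2⟩, rfl⟩)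
  refine hpre.of_isClosed_subset (isClosed_le continuous_logSize continuous_const) fun x hx => ?_
  have h1 := trace_transpose_mul_self_nonneg (x : Matrix (Fin n) (Fin n) ℝ)
  have h2 := trace_transpose_mul_self_nonneg ((x⁻¹ : GL (Fin n) ℝ) : Matrix (Fin n) (Fin n) ℝ)
  have h3 := (Real.log_le_iff_le_exp (by positivity)).1 (show logSize x ≤ R from hx)
  refine ⟨(x, ((x⁻¹ : GL (Fin n) ℝ) : Matrix (Fin n) (Fin n) ℝ)),
    ⟨⟨?_, ?_⟩, Units.mul_inv x, Units.inv_mul x⟩, rfl⟩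
  · refine mem_closedBall_zero_iff.2 (Real.le_sqrt_of_sq_le ?_)
    rw [frobenius_norm_sq]
    linarith
  · refine mem_closedBall_zero_iff.2 (Real.le_sqrt_of_sq_le ?_)
    rw [frobenius_norm_sq]
    linarith

open scoped Matrix.Norms.Frobenius in
theorem exists_compact_closedBall_units :
    ∃ r > 0, IsCompact {s : GL (Fin n) ℝ | ‖(s : Matrix (Fin n) (Fin n) ℝ) - 1‖ ≤ r} := by
  have : ProperSpace (Matrix (Fin n) (Fin n) ℝ) := FiniteDimensional.proper ℝ _
  have hemb : Topology.IsOpenEmbedding (Units.val : (Matrix (Fin n) (Fin n) ℝ)ˣ → _) :=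
    Units.isOpenEmbedding_val
  have h1 : Set.range (Units.val : (Matrix (Fin n) (Fin n) ℝ)ˣ → _) ∈ 𝓝 1 :=
    hemb.isOpen_range.mem_nhds ⟨1, rfl⟩
  obtain ⟨r, hr, hrs⟩ := Metric.nhds_basis_closedBall.mem_iff.1 h1
  refine ⟨r, hr, ?_⟩
  have h2 := hemb.isInducing.isCompact_preimage' (isCompact_closedBall 1 r) hrs
  convert h2 using 1
  ext s
  simp [dist_eq_norm]

open scoped Matrix.Norms.Frobenius in
theorem eventually_norm_exp_sub_one_le {w : Matrix (Fin n) (Fin n) ℝ}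
    (hw : (wᵀ * w).trace = 1) : ∀ᶠ t : ℝ in 𝓝[>] 0, ‖exp (t • w) - 1‖ ≤ 2 * t := by
  have hw1 : ‖w‖ = 1 := by
    have := frobenius_norm_sq w
    rw [hw] at this
    exact (pow_eq_one_iff_of_nonneg (norm_nonneg _) two_ne_zero).1 this
  have h1 := hasDerivAt_iff_tendsto_slope_zero.1 (hasDerivAt_exp_smul_zero w)
  have h2 := (h1.mono_left (nhdsWithin_mono 0 (fun t ht => ne_of_gt ht) :
    𝓝[>] (0 : ℝ) ≤ 𝓝[≠] 0)).norm
  rw [hw1] at h2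
  filter_upwards [h2.eventually (gt_mem_nhds (by norm_num : (1 : ℝ) < 2)), self_mem_nhdsWithin]
    with t ht ht0
  have ht0' : (0 : ℝ) < t := ht0
  rw [zero_add, norm_smul, norm_inv, Real.norm_of_nonneg ht0'.le, zero_smul, exp_zero,
    inv_mul_lt_iff₀ ht0'] at ht
  exact ht.le.trans_eq (mul_comm _ _)

open scoped Matrix.Norms.Frobenius in
/-- From every point of `G`, written as a product `γ * y`, a bounded move between the two factors
decreases `logSize` by a definite amount. -/
theorem exists_descent_step (hG : IsClosed (G : Set (GL (Fin n) ℝ)))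
    (h : IsReductiveLieAlgebra G 𝔤)
    (hT : ∀ g ∈ G, ∃ g' ∈ G, (g' : Matrix (Fin n) (Fin n) ℝ) = (g : Matrix (Fin n) (Fin n) ℝ)ᵀ) :
    ∃ K : Set (GL (Fin n) ℝ), IsCompact K ∧ ∃ δ > 0, ∃ R : ℝ, ∀ γ ∈ G, ∀ y ∈ G,
      ∃ s ∈ K, s ∈ G ∧ logSize (γ * s * y) ≤ max R (logSize (γ * y) - δ) := by
  obtain ⟨c, hc, R, hR⟩ := exists_descent_direction h hT
  obtain ⟨r, hr, hK⟩ := exists_compact_closedBall_units (n := n)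
  have hKG := hK.inter_right hG
  set m : ℝ := ‖(1 : Matrix (Fin n) (Fin n) ℝ)‖ + r with hm
  have hmpos : 0 < m := add_pos_of_nonneg_of_pos (norm_nonneg _) hr
  set κ : ℝ := c / (8 * m) with hκ
  have hκpos : 0 < κ := by positivity
  refine ⟨_, hK, κ * r, by positivity, R, fun γ hγ y hy => ?_⟩
  have hnormc : Continuous fun s : GL (Fin n) ℝ => ‖(s : Matrix (Fin n) (Fin n) ℝ) - 1‖ :=
    continuous_norm.comp (Units.continuous_val.sub continuous_const)
  -- Minimizing a penalized size over a compact ball replaces following a gradient flow. The weight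
  -- κ is chosen so that a move by exp(tw) costs at most tc/4 in penalty, less than the gain of tc/2
  -- in size.
  obtain ⟨s, ⟨hsK, hsG⟩, hmin⟩ := hKG.exists_isMinOn
    (f := fun s => logSize (γ * s * y) + κ * ‖(s : Matrix (Fin n) (Fin n) ℝ) - 1‖)
    ⟨1, by simp [hr.le], G.one_mem⟩
    ((continuous_logSize.comp (by fun_prop)).add (continuous_const.mul hnormc)).continuousOn
  refine ⟨s, hsK, hsG, ?_⟩
  by_cases hsR : logSize (γ * s * y) ≤ R
  · exact le_max_of_le_left hsR
  push Not at hsR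
  refine le_max_of_le_right ?_
  -- An interior minimizer of size above R could still be improved in a descent direction, so the
  -- minimizer lies on the sphere.
  have hs_r : ‖(s : Matrix (Fin n) (Fin n) ℝ) - 1‖ = r := by
    refine le_antisymm hsK (le_of_not_gt fun hlt => ?_)
    obtain ⟨w, hw, hw1, hwe⟩ := hR (γ * s * y) (G.mul_mem (G.mul_mem hγ hsG) hy) hsR γ hγ
    have hex : ∀ t : ℝ, ∃ e : GL (Fin n) ℝ, (e : Matrix (Fin n) (Fin n) ℝ) = exp (t • w) :=
      fun t => Matrix.isUnit_exp _
    choose e he using hex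
    obtain ⟨D, hD, hderiv⟩ := hwe e he
    have he0 : e 0 = 1 := Units.ext (by rw [he, zero_smul, exp_zero, Units.val_one])
    have hslope := (hasDerivAt_iff_tendsto_slope_zero.1 hderiv).mono_left
      (nhdsWithin_mono 0 (fun t ht => ne_of_gt ht) : 𝓝[>] (0 : ℝ) ≤ 𝓝[≠] 0)
    have hsm : ‖(s : Matrix (Fin n) (Fin n) ℝ)‖ ≤ m := by
      have := norm_le_norm_add_norm_sub' (s : Matrix (Fin n) (Fin n) ℝ) 1
      linarith [show ‖(s : Matrix (Fin n) (Fin n) ℝ) - 1‖ ≤ r from hsK]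
    have hsmall : ∀ᶠ t : ℝ in 𝓝[>] 0,
        ‖(s : Matrix (Fin n) (Fin n) ℝ) - 1‖ + 2 * t * m < r := by
      have hcont : ContinuousAt (fun t : ℝ => ‖(s : Matrix (Fin n) (Fin n) ℝ) - 1‖ + 2 * t * m) 0 := by
        fun_prop
      exact nhdsWithin_le_nhds (hcont.eventually_lt continuousAt_const (by simpa using hlt))
    obtain ⟨t, ht1, ht2, ht3, ht0⟩ := ((hslope.eventually (gt_mem_nhds
      (by linarith : D < -(c / 2)))).and ((eventually_norm_exp_sub_one_le hw1).and
        (hsmall.and self_mem_nhdsWithin))).exists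
    have ht0' : (0 : ℝ) < t := ht0
    have hnorm : ‖((e t * s : GL (Fin n) ℝ) : Matrix (Fin n) (Fin n) ℝ) - 1‖ ≤
        ‖(s : Matrix (Fin n) (Fin n) ℝ) - 1‖ + 2 * t * m := by
      have h1 : ((e t * s : GL (Fin n) ℝ) : Matrix (Fin n) (Fin n) ℝ) - 1 =
          ((s : Matrix (Fin n) (Fin n) ℝ) - 1) +
            (exp (t • w) - 1) * (s : Matrix (Fin n) (Fin n) ℝ) := by
        rw [Units.val_mul, he]
        noncomm_ring
      rw [h1]
      refine (norm_add_le _ _).trans (add_le_add le_rfl ((norm_mul_le _ _).trans ?_))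
      exact mul_le_mul ht2 hsm (norm_nonneg _) (by positivity)
    have hmem : e t * s ∈ {s : GL (Fin n) ℝ | ‖(s : Matrix (Fin n) (Fin n) ℝ) - 1‖ ≤ r} ∩ G :=
      ⟨(hnorm.trans ht3.le), G.mul_mem (h.exp_mem _ (𝔤.smul_mem t hw) _ (he t)) hsG⟩
    have hle := hmin hmem
    simp only [Set.mem_ofPred_eq] at hle
    have hassoc : ∀ a : GL (Fin n) ℝ, γ * a * γ⁻¹ * (γ * s * y) = γ * (a * s) * y := fun a => by
      group
    simp only [hassoc, zero_add, he0, one_mul, smul_eq_mul] at ht1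
    rw [inv_mul_lt_iff₀ ht0'] at ht1
    have hκm : κ * (2 * t * m) = t * (c / 4) := by
      rw [hκ]
      field_simp
      norm_num
    have := mul_le_mul_of_nonneg_left hnorm hκpos.le
    have : 0 < t * c := by positivity
    nlinarith
  have h1mem : (1 : GL (Fin n) ℝ) ∈
      {s : GL (Fin n) ℝ | ‖(s : Matrix (Fin n) (Fin n) ℝ) - 1‖ ≤ r} ∩ G :=
    ⟨by simp [hr.le], G.one_mem⟩
  -- Against s = 1, the penalty κ * r paid on the sphere is the guaranteed drop.
  have h1 := hmin h1mem
  simp only [Set.mem_ofPred_eq, hs_r, mul_one, Units.val_one, sub_self, norm_zero, mul_zero,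
    add_zero] at h1
  linarith

end Descent

/-! ### Word lengths for compact generating sets. -/

section WordLength

variable {L : Type*} [Group L]

theorem wordLength_le {S : Set L} {g : L} {k : ℕ} (h : g ∈ S ^ k) : wordLength S g ≤ k :=
  Nat.sInf_le h

theorem exists_mem_pow_of_closure_eq_top {S : Set L} (hS : S⁻¹ = S)
    (hgen : Subgroup.closure S = ⊤) (g : L) : ∃ k : ℕ, g ∈ S ^ k := by
  have hg : g ∈ Subgroup.closure S := hgen ▸ Subgroup.mem_top g
  induction hg using Subgroup.closure_induction with
  | mem x hx => exact ⟨1, by simpa using hx⟩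
  | one => exact ⟨0, by simp⟩
  | mul x y _ _ hx hy =>
    obtain ⟨k, hk⟩ := hx
    obtain ⟨m, hm⟩ := hy
    exact ⟨k + m, pow_add S k m ▸ Set.mul_mem_mul hk hm⟩
  | inv x _ hx =>
    obtain ⟨k, hk⟩ := hx
    refine ⟨k, ?_⟩
    rw [← hS, inv_pow]
    exact Set.inv_mem_inv.2 hk

/-- The term f 1 accounts for the empty product; `logSize` need not vanish at 1. -/
theorem le_add_mul_of_mem_pow {f : L → ℝ} (hf : ∀ x y, f (x * y) ≤ f x + f y) {T : Set L} {A : ℝ}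
    (hA : ∀ x ∈ T, f x ≤ A) (k : ℕ) : ∀ x ∈ T ^ k, f x ≤ f 1 + A * k := by
  induction k with
  | zero => simp
  | succ k ih =>
    intro x hx
    obtain ⟨y, hy, z, hz, rfl⟩ := pow_succ T k ▸ hx
    push_cast
    linarith [hf y z, ih y hy, hA z hz]

variable [TopologicalSpace L]

theorem IsCompactGeneratingSet.mem_pow_wordLength {S : Set L} (hS : IsCompactGeneratingSet S)
    (g : L) : g ∈ S ^ wordLength S g :=
  Nat.sInf_mem (exists_mem_pow_of_closure_eq_top hS.symmetric hS.generates g)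

variable [IsTopologicalGroup L]

/-- If g ∈ S ^ k then gS is a neighborhood of g inside S ^ (k + 1), so the interiors of the powers
form an increasing open cover. -/
theorem IsCompactGeneratingSet.exists_subset_pow {S : Set L} (hS : IsCompactGeneratingSet S)
    {K : Set L} (hK : IsCompact K) : ∃ k : ℕ, K ⊆ S ^ k := by
  have h1 : (1 : L) ∈ S := mem_of_mem_nhds hS.mem_nhds_one
  have hmono : Monotone fun k : ℕ => S ^ k := fun _ _ hkm => Set.pow_subset_pow_right h1 hkm
  obtain ⟨k, hk⟩ := hK.elim_directed_cover (fun k : ℕ => interior (S ^ k))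
    (fun _ => isOpen_interior) (fun g _ => by
      obtain ⟨k, hk⟩ := exists_mem_pow_of_closure_eq_top hS.symmetric hS.generates g
      refine Set.mem_iUnion.2 ⟨k + 1, mem_interior_iff_mem_nhds.2 ?_⟩
      have h2 : g • S ∈ 𝓝 g := by
        simpa using smul_mem_nhds_smul g hS.mem_nhds_one
      refine Filter.mem_of_superset h2 ?_
      rw [pow_succ, ← Set.singleton_smul]
      exact Set.mul_subset_mul_right (Set.singleton_subset_iff.2 hk))
    (directed_of_isDirected_le fun _ _ hkm => interior_mono (hmono hkm))
  exact ⟨k, hk.trans interior_subset⟩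

theorem IsCompactlyGeneratedGroup.exists_isCompactGeneratingSet [LocallyCompactSpace L]
    (h : IsCompactlyGeneratedGroup L) : ∃ S : Set L, IsCompactGeneratingSet S := by
  obtain ⟨K, hK, hgen⟩ := h
  obtain ⟨N, hN, hN1⟩ := exists_compact_mem_nhds (1 : L)
  refine ⟨(K ∪ N) ∪ (K ∪ N)⁻¹, (hK.union hN).union (hK.union hN).inv, ?_, ?_, ?_⟩
  · rw [Set.union_inv, inv_inv, Set.union_comm]
  · exact Filter.mem_of_superset hN1 fun x hx => Or.inl (Or.inr hx)
  · refine top_le_iff.1 (hgen ▸ Subgroup.closure_mono fun x hx => Or.inl (Or.inl hx))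

theorem isCompactlyGeneratedGroup_of_connectedSpace [LocallyCompactSpace L] [ConnectedSpace L] :
    IsCompactlyGeneratedGroup L := by
  obtain ⟨N, hN, hN1⟩ := exists_compact_mem_nhds (1 : L)
  refine ⟨N, hN, ?_⟩
  have hopen : IsOpen (Subgroup.closure N : Set L) :=
    Subgroup.isOpen_of_mem_nhds _ (Filter.mem_of_superset hN1 Subgroup.subset_closure)
  have := IsClopen.eq_univ ⟨Subgroup.isClosed_of_isOpen _ hopen, hopen⟩ ⟨1, one_mem _⟩
  exact SetLike.coe_injective (by rw [this, Subgroup.coe_top])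

end WordLength

/-! ### From the descent step to distances in H. -/

section CompactQuotient

variable {G : Type*} [Group G] [TopologicalSpace G] [IsTopologicalGroup G]

/-- The projection to Γ\G/H is open, so finitely many images of compact neighborhoods cover.
Adjoining 1 lets any h ∈ H start as 1·1·h. -/
theorem exists_compact_fundamental_set [LocallyCompactSpace G] (Γ H : Subgroup G)
    [CompactSpace (Quotient (MulAction.orbitRel Γ (G ⧸ H)))] :
    ∃ C : Set G, IsCompact C ∧ (1 : G) ∈ C ∧
      ∀ g : G, ∃ γ ∈ Γ, ∃ c ∈ C, ∃ h ∈ H, g = γ * c * h := by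
  have : ContinuousConstSMul Γ (G ⧸ H) :=
    ⟨fun γ => (continuous_const_smul (γ : G) : Continuous fun x : G ⧸ H => (γ : G) • x)⟩
  let π : G → Quotient (MulAction.orbitRel Γ (G ⧸ H)) := fun g => Quotient.mk _ (g : G ⧸ H)
  have hπ : IsOpenMap π := (isOpenMap_quotient_mk'_mul (Γ := Γ) (T := G ⧸ H)).comp
    QuotientGroup.isOpenMap_coe
  have hsurj : ∀ q, ∃ g, π g = q := fun q => by
    obtain ⟨x, rfl⟩ := Quotient.exists_rep q
    obtain ⟨g, rfl⟩ := QuotientGroup.mk_surjective x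
    exact ⟨g, rfl⟩
  choose σ hσ using hsurj
  choose N hN hNσ using fun g : G => exists_compact_mem_nhds g
  obtain ⟨t, ht⟩ := CompactSpace.elim_nhds_subcover (fun q => π '' N (σ q)) fun q => by
    have := hπ.image_mem_nhds (hNσ (σ q))
    rwa [hσ] at this
  refine ⟨insert 1 (⋃ q ∈ t, N (σ q)), (t.isCompact_biUnion fun q _ => hN _).insert 1,
    Set.mem_insert _ _, fun g => ?_⟩
  have hg : π g ∈ ⋃ q ∈ t, π '' N (σ q) := ht ▸ Set.mem_univ _
  simp only [Set.mem_iUnion] at hg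
  obtain ⟨q, hq, c, hc, hcg⟩ := hg
  obtain ⟨γ, hγ⟩ := MulAction.orbitRel_apply.1 (Quotient.exact hcg.symm)
  have hγ' : (((γ : G) * c : G) : G ⧸ H) = (g : G ⧸ H) := hγ
  refine ⟨γ, γ.2, c, Set.mem_insert_of_mem _ (Set.mem_biUnion hq hc), _,
    QuotientGroup.eq.1 hγ', ?_⟩
  group

/-- Only finitely many γ move the image of C to meet that of B, and h = c⁻¹γ⁻¹(γch). -/
theorem isCompact_subgroup_component [T2Space G] {Γ H : Subgroup G} (hH : IsClosed (H : Set G))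
    [ProperlyDiscontinuousSMul Γ (G ⧸ H)] {C B : Set G} (hC : IsCompact C) (hB : IsCompact B) :
    ∃ S : Set H, IsCompact S ∧
      ∀ γ ∈ Γ, ∀ c ∈ C, ∀ h : H, γ * c * (h : G) ∈ B → h ∈ S := by
  let p : G → G ⧸ H := QuotientGroup.mk
  have hp : Continuous p := QuotientGroup.continuous_mk
  have hfin := ProperlyDiscontinuousSMul.finite_disjoint_inter_image (Γ := Γ)
    (hC.image hp) (hB.image hp)
  set F : Set G := (fun γ : Γ => (γ : G)) '' {γ : Γ | ((γ • ·) '' (p '' C) ∩ p '' B).Nonempty}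
  have hF : IsCompact F := (hfin.image _).isCompact
  have hK : IsCompact (C⁻¹ * F⁻¹ * B) := (hC.inv.mul hF.inv).mul hB
  refine ⟨Subtype.val ⁻¹' (C⁻¹ * F⁻¹ * B), hH.isClosedEmbedding_subtypeVal.isCompact_preimage hK,
    fun γ hγ c hc h hmemB => ?_⟩
  have hγF : γ ∈ F := by
    refine ⟨⟨γ, hγ⟩, ⟨p (γ * c * h), ⟨p c, ⟨c, hc, rfl⟩, ?_⟩, ⟨_, hmemB, rfl⟩⟩, rfl⟩
    exact (QuotientGroup.mk_mul_of_mem (γ * c) h.2).symm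
  have : (h : G) = c⁻¹ * γ⁻¹ * (γ * c * h) := by group
  rw [Set.mem_preimage, this]
  exact Set.mul_mem_mul (Set.mul_mem_mul (Set.inv_mem_inv.2 hc) (Set.inv_mem_inv.2 hγF)) hmemB

/-- If a size function on `G` can be decreased by bounded moves between the factors of a product,
then it controls word lengths in `H`. -/
theorem exists_compact_mem_pow [T2Space G] [LocallyCompactSpace G] {H : Subgroup G}
    (hH : IsClosed (H : Set G)) (hq : AdmitsCompactQuotients H) {f : G → ℝ} {K : Set G}
    (hK : IsCompact K) {δ R : ℝ} (hR : IsCompact {g | f g ≤ R})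
    (hstep : ∀ γ y : G, ∃ s ∈ K, f (γ * s * y) ≤ max R (f (γ * y) - δ)) (hδ : 0 < δ) :
    ∃ S : Set H, IsCompact S ∧ ∀ (k : ℕ) (h : H), f h ≤ R + k * δ → h ∈ S ^ (k + 1) := by
  obtain ⟨Γ, -, hpd, hcpt⟩ := hq
  obtain ⟨C, hC, h1C, hdec⟩ := exists_compact_fundamental_set Γ H
  obtain ⟨S₁, hS₁, hmem₁⟩ := isCompact_subgroup_component (Γ := Γ) hH hC (hK.mul hC)
  obtain ⟨S₂, hS₂, hmem₂⟩ := isCompact_subgroup_component (Γ := Γ) hH hC hR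
  -- The induction must range over all γ and c, since each move changes them. The exponent k + 1
  -- counts k moves and one last letter at size at most R.
  have key : ∀ (k : ℕ), ∀ γ ∈ Γ, ∀ c ∈ C, ∀ h : H, f (γ * c * h) ≤ R + k * δ →
      h ∈ (S₁⁻¹ ∪ S₂) ^ (k + 1) := by
    intro k
    induction k with
    | zero =>
      intro γ hγ c hc h hf
      rw [zero_add, pow_one]
      exact Or.inr (hmem₂ γ hγ c hc h (by simpa using hf))
    | succ k ih =>
      intro γ hγ c hc h hf
      obtain ⟨s, hs, hfs⟩ := hstep γ (c * h)
      obtain ⟨γ', hγ', c', hc', h', hh', hsc⟩ := hdec (s * c)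
      have h1 : (⟨h', hh'⟩ : H) ∈ S₁ :=
        hmem₁ γ' hγ' c' hc' ⟨h', hh'⟩ (hsc ▸ Set.mul_mem_mul hs hc)
      have hprod : γ * s * (c * h) = γ * γ' * c' * ((⟨h', hh'⟩ * h : H) : G) := by
        rw [Subgroup.coe_mul, mul_assoc γ s, ← mul_assoc s, hsc]
        simp only [mul_assoc]
      have h2 := ih (γ * γ') (Γ.mul_mem hγ hγ') c' hc' (⟨h', hh'⟩ * h) (by
        rw [← hprod]
        refine hfs.trans (max_le (le_add_of_nonneg_right (by positivity)) ?_)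
        rw [← mul_assoc]
        push_cast at hf
        linarith)
      have h3 : h = (⟨h', hh'⟩ : H)⁻¹ * (⟨h', hh'⟩ * h) := by group
      rw [h3, pow_succ' _ (k + 1)]
      exact Set.mul_mem_mul (Or.inl (Set.inv_mem_inv.2 h1)) h2
  exact ⟨_, hS₁.inv.union hS₂, fun k h hf => key k 1 Γ.one_mem 1 h1C h (by simpa using hf)⟩

theorem isQuasiIsometricallyEmbedded_of_size [T2Space G] [LocallyCompactSpace G]
    [ConnectedSpace G] {H : Subgroup G} (hH : IsClosed (H : Set G)) {f : G → ℝ}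
    (hfc : Continuous f) (hf0 : ∀ x, 0 ≤ f x)
    (hf : ∀ x y, f (x * y) ≤ f x + f y) {δ R : ℝ} (hδ : 0 < δ) {S' : Set H} (hS' : IsCompact S')
    (hmem : ∀ (k : ℕ) (h : H), f h ≤ R + k * δ → h ∈ S' ^ (k + 1)) :
    IsCompactlyGeneratedGroup H ∧ IsQuasiIsometricallyEmbedded H := by
  have hlc : LocallyCompactSpace H := hH.isClosedEmbedding_subtypeVal.locallyCompactSpace
  have hgen : IsCompactlyGeneratedGroup H := by
    refine ⟨S', hS', (Subgroup.eq_top_iff' _).2 fun h => ?_⟩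
    obtain ⟨k, hk⟩ := exists_nat_ge ((f h - R) / δ)
    rw [div_le_iff₀ hδ] at hk
    have h1 := hmem k h (by linarith)
    have h2 : ∀ j : ℕ, S' ^ j ⊆ (Subgroup.closure S' : Set H) := fun j => by
      induction j with
      | zero => simp
      | succ j ih =>
        rw [pow_succ]
        rintro _ ⟨a, ha, b, hb, rfl⟩
        exact mul_mem (ih ha) (Subgroup.subset_closure hb)
    exact h2 _ h1
  refine ⟨hgen, hgen.exists_isCompactGeneratingSet,
    isCompactlyGeneratedGroup_of_connectedSpace.exists_isCompactGeneratingSet,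
    fun S T hS hT => ?_⟩
  obtain ⟨k₀, hk₀⟩ := hT.exists_subset_pow (hS.isCompact.image continuous_subtype_val)
  obtain ⟨m, hm⟩ := hS.exists_subset_pow hS'
  obtain ⟨A, hA⟩ := hT.isCompact.exists_bound_of_continuousOn hfc.continuousOn
  have hA' : ∀ x ∈ T, f x ≤ A := fun x hx => (le_abs_self _).trans (hA x hx)
  have hA0 : 0 ≤ A := (norm_nonneg _).trans (hA 1 (mem_of_mem_nhds hT.mem_nhds_one))
  set D : ℝ := m * ((f 1 + |R|) / δ + 2) with hD
  have hD0 : 0 ≤ D := by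
    have := hf0 1
    positivity
  set E : ℝ := max 1 (max k₀ (m * A / δ)) with hE
  have hE1 : 1 ≤ E := le_max_left _ _
  refine ⟨E, D, hE1, hD0, fun h h' => ?_⟩
  set x : H := h⁻¹ * h' with hx
  have hup : (wordLength T (x : G) : ℝ) ≤ k₀ * wordLength S x := by
    have h1 : (x : G) ∈ T ^ (k₀ * wordLength S x) := by
      have h2 : (x : G) ∈ (H.subtype '' S) ^ wordLength S x := by
        rw [← Set.image_pow]
        exact ⟨x, hS.mem_pow_wordLength x, rfl⟩
      rw [pow_mul]
      exact Set.pow_subset_pow_left hk₀ h2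
    exact_mod_cast wordLength_le h1
  have hlow : (wordLength S x : ℝ) ≤ D + m * A / δ * wordLength T (x : G) := by
    have h1 := le_add_mul_of_mem_pow hf hA' _ _ (hT.mem_pow_wordLength (x : G))
    set b : ℝ := (wordLength T (x : G) : ℝ)
    -- Enough steps of size δ to cover f x - R; using |R| keeps the quotient nonnegative. The 2 in D
    -- absorbs the rounding and the extra letter in k + 1.
    set k : ℕ := ⌈(f 1 + |R| + A * b) / δ⌉₊ with hk
    have hnn : 0 ≤ (f 1 + |R| + A * b) / δ := by
      have := hf0 1
      positivity
    have h2 : (f 1 + |R| + A * b) / δ ≤ k := Nat.le_ceil _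
    have h3 : (k : ℝ) < (f 1 + |R| + A * b) / δ + 1 := Nat.ceil_lt_add_one hnn
    rw [div_le_iff₀ hδ] at h2
    have h4 := hmem k x (by linarith [neg_abs_le R])
    have h5 : x ∈ S ^ (m * (k + 1)) := by
      rw [pow_mul]
      exact Set.pow_subset_pow_left hm h4
    have h6 : (wordLength S x : ℝ) ≤ m * (k + 1) := by exact_mod_cast wordLength_le h5
    refine h6.trans ?_
    calc (m : ℝ) * (k + 1) ≤ m * ((f 1 + |R| + A * b) / δ + 2) :=
          mul_le_mul_of_nonneg_left (by linarith) (Nat.cast_nonneg _)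
      _ = D + m * A / δ * b := by
          rw [hD]
          field_simp
          ring
  have hSd : wordDist S h h' = wordLength S x := rfl
  have hTd : wordDist T (h : G) (h' : G) = wordLength T (x : G) := rfl
  rw [hSd, hTd]
  have ha : (0 : ℝ) ≤ wordLength S x := Nat.cast_nonneg _
  have hb : (0 : ℝ) ≤ wordLength T (x : G) := Nat.cast_nonneg _
  constructor
  · have h1 : (wordLength S x : ℝ) ≤ E * (D + wordLength T (x : G)) := by
      have h2 : m * A / δ * wordLength T (x : G) ≤ E * wordLength T (x : G) :=
        mul_le_mul_of_nonneg_right ((le_max_right _ _).trans (le_max_right _ _)) hb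
      nlinarith
    rw [sub_le_iff_le_add, inv_mul_le_iff₀ (by linarith), add_comm]
    exact h1
  · have h2 : (k₀ : ℝ) * wordLength S x ≤ E * wordLength S x :=
      mul_le_mul_of_nonneg_right ((le_max_left _ _).trans (le_max_right _ _)) ha
    linarith

end CompactQuotient

/-! ### The main theorem. -/

theorem theorem1p18 {G : Type*} [Group G] [TopologicalSpace G] [IsTopologicalGroup G]
    [ConnectedSpace G] (hG : IsRealLinearReductive G) (H : Subgroup G)
    (hH : IsClosed (H : Set G)) (hq : AdmitsCompactQuotients H) :
    IsCompactlyGeneratedGroup H ∧ IsQuasiIsometricallyEmbedded H := by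
  obtain ⟨n, ρ, hρ, hT⟩ := hG
  have hT' : ∀ g ∈ ρ.range, ∃ g' ∈ ρ.range,
      (g' : Matrix (Fin n) (Fin n) ℝ) = (g : Matrix (Fin n) (Fin n) ℝ).transpose := by
    rintro _ ⟨g, rfl⟩
    obtain ⟨g', hg'⟩ := hT g
    exact ⟨ρ g', ⟨g', rfl⟩, hg'⟩
  have hclosed : IsClosed (ρ.range : Set (GL (Fin n) ℝ)) := hρ.isClosed_range
  have hconn : ConnectedSpace ρ.range :=
    ρ.rangeRestrict_surjective.connectedSpace (hρ.continuous.subtype_mk _)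
  obtain ⟨𝔤, h𝔤⟩ := exists_isReductiveLieAlgebra hclosed hT'
  obtain ⟨K, hK, δ, hδ, R, hstep⟩ := exists_descent_step hclosed h𝔤 hT'
  have : T2Space G := hρ.isEmbedding.t2Space
  set f : G → ℝ := fun g => logSize (ρ g) with hf
  have hfc : Continuous f := continuous_logSize.comp hρ.continuous
  have hsub : ∀ r, IsCompact {g | f g ≤ r} := fun r =>
    hρ.isCompact_preimage (isCompact_logSize_le r)
  -- Sublevel sets of f are compact, and {f ≤ f g + 1} is a neighborhood of g.
  have : LocallyCompactSpace G := by
    have : WeaklyLocallyCompactSpace G := ⟨fun g => ⟨_, hsub (f g + 1),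
      hfc.continuousAt.preimage_mem_nhds (Iic_mem_nhds (lt_add_one (f g)))⟩⟩
    infer_instance
  obtain ⟨S, hS, hmem⟩ := exists_compact_mem_pow hH hq (hρ.isCompact_preimage hK) (hsub R)
    (fun γ y => by
      obtain ⟨_, hsK, ⟨s, rfl⟩, hs⟩ := hstep (ρ γ) ⟨γ, rfl⟩ (ρ y) ⟨y, rfl⟩
      exact ⟨s, hsK, by simpa [hf] using hs⟩) hδ
  exact isQuasiIsometricallyEmbedded_of_size hH hfc (fun x => logSize_nonneg _)
    (fun x y => by simpa [hf] using logSize_mul_le (ρ x) (ρ y)) hδ hS hmem
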